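/- Let $p,q$ be coprime integers with $q>0$ and $p\neq q$, and let $\zeta=e^{2i\pi/q}$. On $\mathbb P^2$ with homogeneous coordinates $(x:y:z)$ put $\alpha=y\,dz-z\,dy$, $\beta=z\,dx-x\,dz$, $\gamma=x\,dy-y\,dx$. A $k$-web of degree $d$ on $\mathbb P^2$ is given by a symmetric form $P(x,y,z;\alpha,\beta,\gamma)$, where $P(x,y,z;a,b,c)$ is bihomogeneous of degree $d$ in $(x,y,z)$ and $k$ in $(a,b,c)$, the form has isolated zeros and its discriminant is not identically zero. Forms are considered up to multiplication by a nowhere vanishing function. The Legendre transform $\mathrm{Leg}$ of the web given by $P$ is the web on the dual plane, with coordinates $(a:b:c)$, given by $P(b\,dc-c\,db,\;c\,da-a\,dc,\;a\,db-b\,da;\;a,b,c)$. The Legendre transform of a plane curve $C(x,y,z)=0$ is given in the same way by $C(b\,dc-c\,db,\;c\,da-a\,dc,\;a\,db-b\,da)$. A $k$-web is algebraic if it is the Legendre transform of a reduced curve of degree $k$. It is algebraizable if its germ at a generic point is biholomorphically equivalent to the germ of an algebraic $k$-web at a point where the latter has $k$ distinct tangent directions. Let $\mathcal F_{p/q}$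 be the web defined by $$\prod_{n=1}^q\prod_{m=1}^q\left(x^{p/q}\alpha+\zeta^m y^{p/q}\beta+\zeta^n z^{p/q}\gamma\right)$$ and let $\mathbb F_{p/q}$ be the curve $$\prod_{n=1}^q\prod_{m=1}^q\left(x^{p/q}+\zeta^m y^{p/q}+\zeta^n z^{p/q}\right)=0,$$ where for $p<0$ both products are multiplied by $(xyz)^{-pq}$ so that they become polynomial. For $\varepsilon\in\mathbb Q^*$ let $h_\varepsilon$ be the multivalued map $h_\varepsilon(x:y:z)=(x^\varepsilon:y^\varepsilon:z^\varepsilon)$. An equality involving a pull-back by $h_\varepsilon$ means that it holds for every local holomorphic branch of $h_\varepsilon$ on $\{xyz\ne0\}$. (a) If $\varepsilon=\frac{q}{q-p}$, then $h_\varepsilon^*\mathcal F_{p/q}$ is an algebraic web, namely a product of $q^2$ pencils of lines with distinct base points. (b) Assume $p\ne0$. If $\varepsilon=\frac{p}{p-q}$, then $h_\varepsilon^*\mathrm{Leg}(\mathcal F_{p/q})=\mathrm{Leg}(\mathbb F_{p/q})$. In particular $\mathrm{Leg}(\mathcal F_{p/q})$ is an algebraizable $d$-web (of degree $q^2$), where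 $d=pq$ if $p>0$ and $d=-2pq$ if $p<0$. -/

import Mathlib

open MvPolynomial Topology
open scoped Matrix

noncomputable section

namespace PlaneWeb

/-- Homogeneous coordinates on `ℙ²` (or on the dual plane): vectors of `ℂ³`. -/
abbrev Vec : Type := Fin 3 → ℂ

/-- Polynomials `P(x,y,z;a,b,c)`; the variables `Sum.inl i` are `x, y, z` and the variables
`Sum.inr i` are `a, b, c`. -/
abbrev BiPoly : Type := MvPolynomial (Fin 3 ⊕ Fin 3) ℂ

/-- `P` is bihomogeneous, of degree `d` in `x,y,z` and of degree `k` in `a,b,c`. -/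
def IsBihomogeneous (P : BiPoly) (d k : ℕ) : Prop :=
  IsWeightedHomogeneous (Sum.elim (fun _ => 1) (fun _ => 0) : Fin 3 ⊕ Fin 3 → ℕ) P d ∧
    IsWeightedHomogeneous (Sum.elim (fun _ => 0) (fun _ => 1) : Fin 3 ⊕ Fin 3 → ℕ) P k

/-- The value `P(v; a)`. -/
def biEval (P : BiPoly) (v a : Vec) : ℂ := eval (Sum.elim v a) P

/-- The symmetric form `ω = P(x,y,z; α, β, γ)` with `α = y dz - z dy`, `β = z dx - x dz`,
`γ = x dy - y dx`, at the point `v` and evaluated on the tangent vector `ξ`.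
The vector `(α, β, γ)(ξ)` at `v` is the cross product of `v` and `ξ`. -/
def form (P : BiPoly) (v ξ : Vec) : ℂ := biEval P v (crossProduct v ξ)

/-- The point `v` is a regular point of the `k`-web defined by `P`: exactly `k` distinct lines
`a` through `v` are tangent to the web at `v` (the discriminant does not vanish at `v`). -/
def RegularAt (P : BiPoly) (k : ℕ) (v : Vec) : Prop :=
  v ≠ 0 ∧ {a : Projectivization ℂ Vec | a.rep ⬝ᵥ v = 0 ∧ biEval P v a.rep = 0}.encard = k

/-- `P` defines a `k`-web of degree `d` on the projective plane: `P` has bidegree `(d, k)`, the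
discriminant is not identically zero, and the form `ω` has isolated zeros only. -/
def IsWeb (P : BiPoly) (k d : ℕ) : Prop :=
  IsBihomogeneous P d k ∧ (∃ v : Vec, RegularAt P k v) ∧
    {v : Projectivization ℂ Vec | ∀ ξ : Vec, form P v.rep ξ = 0}.Finite

/-- The Legendre transform: the roles of `(x,y,z)` and `(a,b,c)` are exchanged, so that
`P(x,y,z; α, β, γ)` becomes `P(b dc - c db, c da - a dc, a db - b da; a, b, c)`. -/
def leg (P : BiPoly) : BiPoly := rename Sum.swap P

/-- The Legendre transform of the plane curve `{C = 0}`, the curve being seen as a `0`-web. -/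
def legCurve (C : MvPolynomial (Fin 3) ℂ) : BiPoly := leg (rename Sum.inl C)

/-- The `k`-web defined by `P` is algebraic: it is the Legendre transform of a reduced plane curve
of degree `k`. -/
def IsAlgebraicWeb (P : BiPoly) (k : ℕ) : Prop :=
  ∃ C : MvPolynomial (Fin 3) ℂ, C.IsHomogeneous k ∧ Squarefree C ∧ P = legCurve C

/-- The pencil of lines through the point `w`: the foliation `w₀ α + w₁ β + w₂ γ = 0`. -/
def pencil (w : Vec) : BiPoly := ∑ i, C (w i) * X (Sum.inr i)

/-- Near `v`, the map `Φ` lifts to homogeneous coordinates the germ at the point `v` of a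
biholomorphism between open subsets of projective planes: it is holomorphic, it sends radial
directions to radial directions, and the induced map on the plane has invertible derivative. -/
def IsBiholomorphicLift (Φ : Vec → Vec) (v : Vec) : Prop :=
  v ≠ 0 ∧ Φ v ≠ 0 ∧ AnalyticAt ℂ Φ v ∧
    (∀ᶠ u in 𝓝 v, ∃ c : ℂ, fderiv ℂ Φ u u = c • Φ u) ∧
    ∀ ξ : Vec, (∃ c : ℂ, fderiv ℂ Φ v ξ = c • Φ v) → ∃ c : ℂ, ξ = c • v

/-- The germ at `v` of the web `P` is the pull-back, by the germ of biholomorphism lifted by `Φ`,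
of the germ at `Φ v` of the web `Q`. Forms defining the same web differ by a holomorphic factor
without zeros. -/
def GermEquivBy (Φ : Vec → Vec) (P Q : BiPoly) (v : Vec) : Prop :=
  IsBiholomorphicLift Φ v ∧
    ∃ g : Vec → ℂ, AnalyticAt ℂ g v ∧ g v ≠ 0 ∧
      ∀ᶠ u in 𝓝 v, ∀ ξ : Vec, form Q (Φ u) (fderiv ℂ Φ u ξ) = g u * form P u ξ

/-- The germ of the `k`-web `P` at `v` is algebraizable: it is biholomorphically equivalent to
the germ of the Legendre transform of a reduced curve of degree `k`, at a line which meets that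
curve in `k` distinct points. -/
def IsAlgebraizableAt (P : BiPoly) (k : ℕ) (v : Vec) : Prop :=
  ∃ Q : BiPoly, IsAlgebraicWeb Q k ∧
    ∃ Φ : Vec → Vec, RegularAt Q k (Φ v) ∧ GermEquivBy Φ P Q v

/-- The `k`-web `P` is algebraizable: its germ at a generic point (in the complement of some
curve) is algebraizable. -/
def IsAlgebraizable (P : BiPoly) (k : ℕ) : Prop :=
  ∃ (e : ℕ) (D : MvPolynomial (Fin 3) ℂ), D.IsHomogeneous e ∧ D ≠ 0 ∧
    ∀ v : Vec, v ≠ 0 → eval v D ≠ 0 → IsAlgebraizableAt P k v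

/-- `Φ` is on `U` a holomorphic branch, in homogeneous coordinates, of the multivalued map
`h_ε(x:y:z) = (x^ε : y^ε : z^ε)`: with `ε = r/s` in lowest terms, `Φᵢ(v)^s = vᵢ^r`. -/
def IsPowerBranch (ε : ℚ) (U : Set Vec) (Φ : Vec → Vec) : Prop :=
  IsOpen U ∧ (∀ v ∈ U, ∀ i, v i ≠ 0) ∧ DifferentiableOn ℂ Φ U ∧
    ∀ v ∈ U, ∀ i, Φ v i ^ ε.den = v i ^ ε.num

/-- `h_ε^* P = Q` as webs: for every holomorphic branch of the multivalued map `h_ε`, the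
pull-back of the form of `P` is the form of `Q` times a holomorphic function without zeros. -/
def IsPowerPullback (ε : ℚ) (P Q : BiPoly) : Prop :=
  ∀ (U : Set Vec) (Φ : Vec → Vec), IsPowerBranch ε U Φ →
    ∃ g : Vec → ℂ, DifferentiableOn ℂ g U ∧ (∀ v ∈ U, g v ≠ 0) ∧
      ∀ v ∈ U, ∀ ξ : Vec, form P (Φ v) (fderiv ℂ Φ v ξ) = g v * form Q v ξ

/-- The root of unity `e^{2 i π / q}`. -/
def zeta (q : ℕ) : ℂ := Complex.exp (2 * Real.pi * Complex.I / q)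

/-- The polynomial `∏ₘ ∏ₙ (X + ζ^m Y + ζ^n Z)`, `1 ≤ m, n ≤ q`, where `ζ = e^{2 i π / q}`. -/
def triProd (q : ℕ) : MvPolynomial (Fin 3) ℂ :=
  ∏ m ∈ Finset.Icc 1 q, ∏ n ∈ Finset.Icc 1 q,
    (X 0 + C (zeta q ^ m) * X 1 + C (zeta q ^ n) * X 2)

/-- The polynomial `N` with `N(X^q, Y^q, Z^q) = ∏ₘ ∏ₙ (X + ζ^m Y + ζ^n Z)`; see `eval_triNorm`. -/
def triNorm (q : ℕ) : MvPolynomial (Fin 3) ℂ :=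
  ∑ e ∈ (triProd q).support,
    monomial (e.mapRange (fun j => j / q) (Nat.zero_div q)) (coeff e (triProd q))

/-- The homogeneous polynomials `(x^p, y^p, z^p)`; when `p < 0` they are multiplied by the common
factor `(xyz)^{-p}`, which gives `((yz)^{-p}, (zx)^{-p}, (xy)^{-p})`. -/
def powCoord (p : ℤ) (i : Fin 3) : MvPolynomial (Fin 3) ℂ :=
  if 0 ≤ p then X i ^ p.toNat else (X (i + 1) * X (i + 2)) ^ (-p).toNat

/-- The triangular-symmetric curve `∏ₘ ∏ₙ (x^{p/q} + ζ^m y^{p/q} + ζ^n z^{p/q}) = 0`, the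
denominators being cleared when `p < 0`. -/
def triCurve (p : ℤ) (q : ℕ) : MvPolynomial (Fin 3) ℂ := bind₁ (powCoord p) (triNorm q)

/-- The web `𝓕_{p/q}`, given by `∏ₘ ∏ₙ (x^{p/q} α + ζ^m y^{p/q} β + ζ^n z^{p/q} γ)`, the
denominators being cleared when `p < 0`. -/
def triWeb (p : ℤ) (q : ℕ) : BiPoly :=
  bind₁ (fun i => rename Sum.inl (powCoord p i) * X (Sum.inr i) ^ q) (triNorm q)

/-- The degree of `𝓕_{p/q}`: `pq` if `p > 0` and `-2pq` if `p < 0`. -/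
def triDegree (p : ℤ) (q : ℕ) : ℕ := (if 0 < p then p * q else -2 * p * q).toNat

theorem zeta_isPrimitiveRoot {q : ℕ} (hq : 0 < q) : IsPrimitiveRoot (zeta q) q :=
  Complex.isPrimitiveRoot_exp q hq.ne'

theorem prod_Icc_zeta_shift {q : ℕ} (hq : 0 < q) (f : ℂ → ℂ) :
    ∏ m ∈ Finset.Icc 1 q, f (zeta q * zeta q ^ m) = ∏ m ∈ Finset.Icc 1 q, f (zeta q ^ m) := by
  have h := zeta_isPrimitiveRoot hq
  have e1 : ∀ F : ℕ → ℂ, ∏ m ∈ Finset.Icc 1 q, F m = ∏ m ∈ Finset.range q, F (m + 1) := by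
    intro F
    rw [Finset.range_eq_Ico, Finset.prod_Ico_add' F 0 q 1, zero_add]
    rfl
  rw [e1, e1]
  obtain ⟨r, rfl⟩ : ∃ r, q = r + 1 := ⟨q - 1, by omega⟩
  rw [Finset.prod_range_succ, Finset.prod_range_succ' (fun m => f (zeta (r + 1) ^ (m + 1)))]
  congr 1
  · refine Finset.prod_congr rfl fun m _ => ?_
    rw [← pow_succ']
  · rw [h.pow_eq_one]; simp

theorem eval_triProd (q : ℕ) (t : Vec) : eval t (triProd q) =
    ∏ m ∈ Finset.Icc 1 q, ∏ n ∈ Finset.Icc 1 q, (t 0 + zeta q ^ m * t 1 + zeta q ^ n * t 2) := by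
  simp [triProd]

theorem eval_triProd_update {q : ℕ} (hq : 0 < q) (t : Vec) (i : Fin 3) :
    eval (fun j => (if j = i then zeta q else 1) * t j) (triProd q) = eval t (triProd q) := by
  have h := zeta_isPrimitiveRoot hq
  have h0 : zeta q ≠ 0 := Complex.exp_ne_zero _
  have h2 : ∀ s : Vec, eval (fun j => (if j = 2 then zeta q else 1) * s j) (triProd q)
      = eval s (triProd q) := by
    intro s
    rw [eval_triProd, eval_triProd]
    refine Finset.prod_congr rfl fun m _ => ?_
    rw [← prod_Icc_zeta_shift hq (fun w => s 0 + zeta q ^ m * s 1 + w * s 2)]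
    refine Finset.prod_congr rfl fun n _ => ?_
    simp; ring
  have h1 : ∀ s : Vec, eval (fun j => (if j = 1 then zeta q else 1) * s j) (triProd q)
      = eval s (triProd q) := by
    intro s
    rw [eval_triProd, eval_triProd]
    rw [← prod_Icc_zeta_shift hq
      (fun w => ∏ n ∈ Finset.Icc 1 q, (s 0 + w * s 1 + zeta q ^ n * s 2))]
    refine Finset.prod_congr rfl fun m _ => Finset.prod_congr rfl fun n _ => ?_
    simp; ring
  have hs : ∀ s : Vec, eval (fun j => zeta q * s j) (triProd q) = eval s (triProd q) := by
    intro s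
    rw [eval_triProd, eval_triProd]
    have : ∀ m n : ℕ, zeta q * s 0 + zeta q ^ m * (zeta q * s 1) + zeta q ^ n * (zeta q * s 2)
        = zeta q * (s 0 + zeta q ^ m * s 1 + zeta q ^ n * s 2) := by intros; ring
    simp [this, Finset.prod_mul_distrib, h.pow_eq_one]
  fin_cases i
  · have e1 := h2 (fun j => (if j = 1 then zeta q else 1) * ((if j = 0 then zeta q else 1) * t j))
    rw [h1 (fun j => (if j = 0 then zeta q else 1) * t j)] at e1
    refine e1.symm.trans ?_
    rw [← hs t]
    congr 2
    funext j
    fin_cases j <;> simp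
  · exact h1 t
  · exact h2 t

theorem dvd_of_mem_support_triProd {q : ℕ} (hq : 0 < q) {e : Fin 3 →₀ ℕ}
    (he : e ∈ (triProd q).support) (i : Fin 3) : q ∣ e i := by
  have h := zeta_isPrimitiveRoot hq
  have key : bind₁ (fun j => C (if j = i then zeta q else 1) * X j : Fin 3 → MvPolynomial (Fin 3) ℂ)
      (triProd q) = triProd q := by
    refine MvPolynomial.funext fun t => ?_
    rw [← eval_triProd_update hq t i]
    simp only [← coe_aeval_eq_eval, RingHom.coe_coe]
    rw [aeval_bind₁]
    simp
  have aux : ∀ (u : Fin 3 →₀ ℕ) (a : ℂ), bind₁ (fun j => C (if j = i then zeta q else 1)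
      * X j : Fin 3 → MvPolynomial (Fin 3) ℂ) (monomial u a) =
      C a * ∏ j, (C (if j = i then zeta q else 1) * X j : MvPolynomial (Fin 3) ℂ) ^ u j := by
    intro u a
    rw [monomial_eq, Finsupp.prod_fintype _ _ (by simp)]
    simp
  have hc : ∀ P : MvPolynomial (Fin 3) ℂ, coeff e (bind₁ (fun j => C (if j = i then zeta q else 1)
      * X j : Fin 3 → MvPolynomial (Fin 3) ℂ) P) = zeta q ^ e i * coeff e P := by
    intro P
    induction P using MvPolynomial.induction_on' with
    | monomial u a =>
      have : bind₁ (fun j => C (if j = i then zeta q else 1)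
          * X j : Fin 3 → MvPolynomial (Fin 3) ℂ) (monomial u a) =
          monomial u (zeta q ^ u i * a) := by
        have h3 : ∏ j, (C (if j = i then zeta q else 1) : MvPolynomial (Fin 3) ℂ) ^ u j
            = C (zeta q ^ u i) := by
          rw [Finset.prod_eq_single i]
          · simp
          · intro j _ hj; simp [hj]
          · simp
        rw [aux u a, Finset.prod_congr rfl (fun j _ => mul_pow _ _ _), Finset.prod_mul_distrib, h3,
          monomial_eq, Finsupp.prod_fintype _ _ (by simp), C_mul]
        ring
      rw [this, coeff_monomial, coeff_monomial]
      split_ifs with hu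
      · rw [hu]
      · simp
    | add P Q hP hQ => rw [map_add, coeff_add, coeff_add, hP, hQ]; ring
  have h4 := hc (triProd q)
  rw [key] at h4
  have h5 : coeff e (triProd q) ≠ 0 := mem_support_iff.mp he
  have h6 : zeta q ^ e i = 1 := by
    have : (zeta q ^ e i - 1) * coeff e (triProd q) = 0 := by linear_combination -h4
    rcases mul_eq_zero.mp this with h7 | h7
    · linear_combination h7
    · exact absurd h7 h5
  exact h.dvd_of_pow_eq_one _ h6

/-- The defining property of `triNorm`. -/
theorem eval_triNorm {q : ℕ} (hq : 0 < q) (t : Vec) : eval (fun i => t i ^ q) (triNorm q) =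
    ∏ m ∈ Finset.Icc 1 q, ∏ n ∈ Finset.Icc 1 q, (t 0 + zeta q ^ m * t 1 + zeta q ^ n * t 2) := by
  rw [← eval_triProd, triNorm, map_sum, eval_eq']
  refine Finset.sum_congr rfl fun e he => ?_
  rw [eval_monomial, Finsupp.prod_fintype _ _ (by simp)]
  congr 1
  refine Finset.prod_congr rfl fun i _ => ?_
  rw [Finsupp.mapRange_apply, ← pow_mul, Nat.mul_div_cancel' (dvd_of_mem_support_triProd hq he i)]

end PlaneWeb

end

open MvPolynomial Topology
open scoped Matrix

noncomputable section

namespace PlaneWeb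

/-! Write `N` for `triNorm q`, homogeneous of degree `q`. Up to clearing denominators, the form of
`𝓕_{p/q}` is `N(x^p α^q, y^p β^q, z^p γ^q)` and the curve `𝔽_{p/q}` is `N(x^p, y^p, z^p) = 0`. A
power map `u_i = v_i^e` satisfies `du_i/u_i = e dv_i/v_i`, so on conormal coordinates it acts
diagonally, by `v_i/u_i` times a factor common to all three (`crossProduct_of_logDeriv`);
homogeneity of `N` takes common factors out. Part (a) is then the identity `u_i^p (v_i/u_i)^q = 1`,
which leaves `N(α^q, β^q, γ^q)`, a product of linear forms with constant coefficients. Part (b) is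
the identity `(v_i/u_i)^p u_i^q = 1`.

The inverse power map carries germs of `Leg 𝓕_{p/q}` to germs of `Leg 𝔽_{p/q}`. Three things remain
for algebraizability and the web conditions. The curve is reduced: with two coordinates fixed, `N`
splits into binomials in the third (`eval_triNorm_eq_prod`), and squarefreeness of one such fibre
lifts to the plane (`squarefree_of_specialize`). Generic points are regular: a reduced curve has a
transversal line (`exists_separable_restrictLine`), transversality is the nonvanishing of a
discriminant, and it passes through the power map. The zeros are isolated: at a zero of the form,
suitable tangent vectors annihilate an argument of `N`, which makes every ratio of nonzero
coordinates a root of unity (`div_zpow_eq_one_of_form_eq_zero`). -/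

/-! ### Homogeneity and degrees of the web and of the curve -/

theorem eval_bind₁_eq {σ τ : Type*} (x : τ → ℂ) (g : σ → MvPolynomial τ ℂ)
    (φ : MvPolynomial σ ℂ) : eval x (bind₁ g φ) = eval (fun i => eval x (g i)) φ := by
  simp only [← coe_aeval_eq_eval, RingHom.coe_coe, aeval_bind₁]

theorem eval_smul_of_isHomogeneous {σ : Type*} [Fintype σ] {φ : MvPolynomial σ ℂ} {n : ℕ}
    (hφ : φ.IsHomogeneous n) (c : ℂ) (x : σ → ℂ) :
    eval (fun i => c * x i) φ = c ^ n * eval x φ := by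
  rw [eval_eq', eval_eq', Finset.mul_sum]
  refine Finset.sum_congr rfl fun e he => ?_
  have h : ∑ i, e i = n := by
    rw [← Finsupp.degree_eq_sum, Finsupp.degree_eq_weight_one]
    exact hφ (mem_support_iff.mp he)
  simp only [mul_pow, Finset.prod_mul_distrib, Finset.prod_pow_eq_pow_sum, h]
  ring

theorem isWeightedHomogeneous_bind₁ {σ τ : Type*} {w : τ → ℕ} {g : σ → MvPolynomial τ ℂ}
    {φ : MvPolynomial σ ℂ} {n m : ℕ} (hφ : φ.IsHomogeneous n)
    (hg : ∀ i, IsWeightedHomogeneous w (g i) m) :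
    IsWeightedHomogeneous w (bind₁ g φ) (n * m) := by
  rw [φ.as_sum, map_sum]
  refine IsWeightedHomogeneous.sum _ _ _ fun e he => ?_
  have h : e.degree = n := by
    rw [Finsupp.degree_eq_weight_one]
    exact hφ (mem_support_iff.mp he)
  rw [bind₁_monomial, ← h]
  refine IsWeightedHomogeneous.C_mul ?_ _
  have := IsWeightedHomogeneous.prod e.support (fun i => g i ^ e i) (fun i => e i * m) (w := w)
    fun i _ => by simpa using (hg i).pow (e i)
  rwa [← Finset.sum_mul] at this

theorem isHomogeneous_triProd (q : ℕ) : (triProd q).IsHomogeneous (q * q) := by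
  have h : ∀ a b : ℂ, (X 0 + C a * X 1 + C b * X 2 : MvPolynomial (Fin 3) ℂ).IsHomogeneous 1 :=
    fun a b => ((isHomogeneous_X ℂ 0).add (isHomogeneous_C_mul_X a 1)).add
      (isHomogeneous_C_mul_X b 2)
  have := IsHomogeneous.prod (Finset.Icc 1 q) _ (fun _ => q) fun m _ => by
    simpa using IsHomogeneous.prod (Finset.Icc 1 q) _ (fun _ => 1)
      fun n _ => h (zeta q ^ m) (zeta q ^ n)
  simpa [triProd] using this

theorem isHomogeneous_triNorm {q : ℕ} (hq : 0 < q) : (triNorm q).IsHomogeneous q := by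
  refine IsHomogeneous.sum _ _ _ fun e he => isHomogeneous_monomial _ ?_
  have h : e.degree = q * q := by
    rw [Finsupp.degree_eq_weight_one]
    exact isHomogeneous_triProd q (mem_support_iff.mp he)
  have h3 := fun i => dvd_of_mem_support_triProd hq he i
  rw [Finsupp.degree_eq_sum] at h ⊢
  refine Nat.eq_of_mul_eq_mul_left hq ?_
  rw [← h, Finset.mul_sum]
  exact Finset.sum_congr rfl fun i _ => Nat.mul_div_cancel' (h3 i)

/-- The common degree of the polynomials `powCoord p i`. -/
def powDegree (p : ℤ) : ℕ := if 0 ≤ p then p.toNat else 2 * (-p).toNat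

theorem mul_powDegree {p : ℤ} (hp : p ≠ 0) (q : ℕ) : q * powDegree p = triDegree p q := by
  unfold powDegree triDegree
  zify
  split_ifs with h1 h2 h2
  · rw [Int.toNat_of_nonneg h1, Int.toNat_of_nonneg (by positivity)]; ring
  · omega
  · omega
  · rw [Int.toNat_of_nonneg (by omega), Int.toNat_of_nonneg (by nlinarith)]; ring

theorem isHomogeneous_powCoord (p : ℤ) (i : Fin 3) :
    (powCoord p i).IsHomogeneous (powDegree p) := by
  unfold powCoord powDegree
  split_ifs
  · exact isHomogeneous_X_pow _ _
  · exact ((isHomogeneous_X ℂ _).mul (isHomogeneous_X ℂ _)).pow _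

theorem isHomogeneous_triCurve (p : ℤ) {q : ℕ} (hq : 0 < q) :
    (triCurve p q).IsHomogeneous (q * powDegree p) :=
  isWeightedHomogeneous_bind₁ (isHomogeneous_triNorm hq) (isHomogeneous_powCoord p)

theorem leg_triWeb (p : ℤ) (q : ℕ) : leg (triWeb p q) =
    bind₁ (fun i => rename Sum.inr (powCoord p i) * X (Sum.inl i) ^ q) (triNorm q) := by
  rw [leg, triWeb, ← AlgHom.comp_apply]
  congr 1
  ext i
  simp only [AlgHom.comp_apply, bind₁_X_right, map_mul, rename_rename, map_pow, rename_X]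
  rfl

theorem isBihomogeneous_leg_triWeb (p : ℤ) {q : ℕ} (hq : 0 < q) :
    IsBihomogeneous (leg (triWeb p q)) (q ^ 2) (q * powDegree p) := by
  rw [leg_triWeb]
  have hX : ∀ (w : Fin 3 ⊕ Fin 3 → ℕ) (j : Fin 3 ⊕ Fin 3) (k : ℕ), w j = k →
      IsWeightedHomogeneous w (X j : BiPoly) k :=
    fun w j k h => h ▸ isWeightedHomogeneous_X ℂ w j
  constructor
  · rw [pow_two]
    refine isWeightedHomogeneous_bind₁ (isHomogeneous_triNorm hq) fun i => ?_
    rw [← zero_add q]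
    refine IsWeightedHomogeneous.mul ?_ ?_
    · unfold powCoord
      split_ifs
      · rw [map_pow, rename_X]
        simpa using (hX _ (Sum.inr i) 0 rfl).pow p.toNat
      · rw [map_pow, map_mul, rename_X, rename_X]
        simpa using ((hX _ (Sum.inr (i + 1)) 0 rfl).mul (hX _ (Sum.inr (i + 2)) 0 rfl)).pow
          (-p).toNat
    · simpa using (hX _ (Sum.inl i) 1 rfl).pow q
  · refine isWeightedHomogeneous_bind₁ (isHomogeneous_triNorm hq) fun i => ?_
    rw [← add_zero (powDegree p)]
    refine IsWeightedHomogeneous.mul ?_ ?_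
    · unfold powCoord powDegree
      split_ifs
      · rw [map_pow, rename_X]
        simpa using (hX _ (Sum.inr i) 1 rfl).pow p.toNat
      · rw [map_pow, map_mul, rename_X, rename_X, mul_comm 2]
        simpa using ((hX _ (Sum.inr (i + 1)) 1 rfl).mul (hX _ (Sum.inr (i + 2)) 1 rfl)).pow
          (-p).toNat
    · simpa using (hX _ (Sum.inl i) 0 rfl).pow q

/-! ### Values of the forms, and powers of diagonal scalings -/

theorem biEval_leg (P : BiPoly) (v a : Vec) : biEval (leg P) v a = biEval P a v := by
  rw [biEval, leg, eval_rename, biEval]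
  congr 2
  funext i
  rcases i with i | i <;> rfl

theorem biEval_legCurve (Q : MvPolynomial (Fin 3) ℂ) (v a : Vec) :
    biEval (legCurve Q) v a = eval a Q := by
  rw [legCurve, biEval_leg, biEval, eval_rename]
  rfl

theorem biEval_triWeb (p : ℤ) (q : ℕ) (v a : Vec) : biEval (triWeb p q) v a =
    eval (fun i => eval v (powCoord p i) * a i ^ q) (triNorm q) := by
  rw [biEval, triWeb, eval_bind₁_eq]
  congr 2
  funext i
  simp only [map_mul, map_pow, eval_rename, eval_X, Sum.elim_inr]
  rfl

theorem eval_triCurve (p : ℤ) (q : ℕ) (a : Vec) : eval a (triCurve p q) =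
    eval (fun i => eval a (powCoord p i)) (triNorm q) := by
  rw [triCurve, eval_bind₁_eq]

theorem biEval_pencil (w v a : Vec) : biEval (pencil w) v a = ∑ i, w i * a i := by
  simp [biEval, pencil]

/-- The factor by which `powCoord p` fails to be the plain `p`-th power. -/
def powFactor (p : ℤ) (D : Vec) : ℂ := (∏ i, D i) ^ (-p).toNat

theorem powFactor_ne_zero (p : ℤ) {D : Vec} (hD : ∀ i, D i ≠ 0) : powFactor p D ≠ 0 :=
  pow_ne_zero _ (Finset.prod_ne_zero_iff.mpr fun i _ => hD i)

/-- For `p ≥ 0` the exponent `(-p).toNat` is `0` and `powFactor` is `1`; for `p < 0`, `(D_{i+1}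
D_{i+2})^{-p} = (∏ D)^{-p} D_i^p`. The factor does not depend on `i`, so both signs of `p` can be
treated together by homogeneity. -/
theorem eval_powCoord_mul (p : ℤ) {D : Vec} (hD : ∀ i, D i ≠ 0) (a : Vec) (i : Fin 3) :
    eval (fun j => D j * a j) (powCoord p i) =
      powFactor p D * D i ^ p * eval a (powCoord p i) := by
  unfold powCoord powFactor
  split_ifs with h
  · obtain ⟨n, rfl⟩ := Int.eq_ofNat_of_zero_le h
    simp [mul_pow]
  · obtain ⟨n, hn⟩ := Int.eq_ofNat_of_zero_le (show 0 ≤ -p by omega)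
    obtain rfl : p = -n := by omega
    have h1 : ∏ j, D j = D i * (D (i + 1) * D (i + 2)) := by
      fin_cases i <;> simp [Fin.prod_univ_three] <;> ring
    have h2 : D i ^ n * (D i ^ n)⁻¹ = 1 := mul_inv_cancel₀ (pow_ne_zero _ (hD i))
    simp only [neg_neg, Int.toNat_natCast, map_pow, map_mul, eval_X, h1, zpow_neg, zpow_natCast]
    simp only [mul_pow]
    linear_combination -(D (i + 1) ^ n * D (i + 2) ^ n * a (i + 1) ^ n * a (i + 2) ^ n) * h2

theorem eval_powCoord (p : ℤ) {v : Vec} (hv : ∀ i, v i ≠ 0) (i : Fin 3) :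
    eval v (powCoord p i) = powFactor p v * v i ^ p := by
  have h : eval (fun _ => 1) (powCoord p i) = (1 : ℂ) := by
    unfold powCoord; split_ifs <;> simp
  simpa [h] using eval_powCoord_mul p hv (fun _ => 1) i

theorem eval_triNorm_smul {q : ℕ} (hq : 0 < q) (c : ℂ) (z : Vec) :
    eval (fun i => c * z i) (triNorm q) = c ^ q * eval z (triNorm q) :=
  eval_smul_of_isHomogeneous (isHomogeneous_triNorm hq) c z

theorem eval_triProd_eq_triNorm {q : ℕ} (hq : 0 < q) (t : Vec) :
    eval t (triProd q) = eval (fun i => t i ^ q) (triNorm q) := by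
  rw [eval_triProd, eval_triNorm hq]

/-- Makes the reducedness of the line arrangement in part (a) the case `p = q` of that of
`triCurve`. -/
theorem triCurve_self {q : ℕ} (hq : 0 < q) : triCurve q q = triProd q := by
  refine MvPolynomial.funext fun t => ?_
  rw [eval_triCurve, eval_triProd_eq_triNorm hq]
  simp [powCoord]

/-! ### Factorisation of `N` over the roots of unity -/

theorem prod_Icc_zeta_shift_pow {q : ℕ} (hq : 0 < q) (f : ℂ → ℂ) (k : ℕ) :
    ∏ m ∈ Finset.Icc 1 q, f (zeta q ^ k * zeta q ^ m) = ∏ m ∈ Finset.Icc 1 q, f (zeta q ^ m) := by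
  induction k with
  | zero => simp
  | succ k ih =>
    rw [← ih, ← prod_Icc_zeta_shift hq (fun w => f (zeta q ^ k * w))]
    refine Finset.prod_congr rfl fun m _ => ?_
    ring_nf

theorem injOn_zeta_pow {q : ℕ} (hq : 0 < q) :
    Set.InjOn (fun m => zeta q ^ m) (Finset.Icc 1 q : Finset ℕ) := by
  intro i hi j hj hij
  have h := zeta_isPrimitiveRoot hq
  rw [Finset.mem_coe, Finset.mem_Icc] at hi hj
  obtain ⟨i, rfl⟩ : ∃ k, i = k + 1 := ⟨i - 1, by omega⟩
  obtain ⟨j, rfl⟩ : ∃ k, j = k + 1 := ⟨j - 1, by omega⟩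
  have h0 : zeta q ≠ 0 := Complex.exp_ne_zero _
  simp only [pow_succ, mul_eq_mul_right_iff, h0, or_false] at hij
  rw [h.pow_inj (by omega) (by omega) hij]

theorem prod_Icc_zeta_add {q : ℕ} (hq : 0 < q) (x y : ℂ) :
    ∏ m ∈ Finset.Icc 1 q, (x + zeta q ^ m * y) = x ^ q - (-y) ^ q := by
  have hz := zeta_isPrimitiveRoot hq
  have h := hz.pow_sub_pow_eq_prod_sub_mul x (-y) hq
  have h1 : (Finset.Icc 1 q).image (fun m => zeta q ^ m) =
      Polynomial.nthRootsFinset q (1 : ℂ) := by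
    refine Finset.eq_of_subset_of_card_le (fun z hz' => ?_) ?_
    · obtain ⟨m, -, rfl⟩ := Finset.mem_image.mp hz'
      rw [Polynomial.mem_nthRootsFinset hq, ← pow_mul, mul_comm, pow_mul, hz.pow_eq_one, one_pow]
    · rw [Finset.card_image_of_injOn (injOn_zeta_pow hq), hz.card_nthRootsFinset]
      simp
  rw [h, ← h1, Finset.prod_image (injOn_zeta_pow hq)]
  refine Finset.prod_congr rfl fun m _ => ?_
  ring

/-- The factorisation of `N` as a binary form in its first variable and a multiple of the others. -/
theorem eval_triNorm_eq_prod {q : ℕ} (hq : 0 < q) (Z W s₁ s₂ : ℂ) :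
    eval ![Z, W * s₁ ^ q, W * s₂ ^ q] (triNorm q) =
      ∏ k ∈ Finset.Icc 1 q, (Z - (-1) ^ q * (s₁ + zeta q ^ k * s₂) ^ q * W) := by
  obtain ⟨τ, rfl⟩ := IsAlgClosed.exists_pow_nat_eq Z hq
  obtain ⟨ω, rfl⟩ := IsAlgClosed.exists_pow_nat_eq W hq
  have h : (![τ ^ q, ω ^ q * s₁ ^ q, ω ^ q * s₂ ^ q] : Vec) =
      fun i => (![τ, ω * s₁, ω * s₂] : Vec) i ^ q := by
    funext i
    fin_cases i <;> simp [mul_pow]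
  rw [h, eval_triNorm hq]
  simp only [Matrix.cons_val_zero, Matrix.cons_val_one, Matrix.cons_val]
  -- Shifting `n` by `m` brings out `ζ^m` from both last terms; the product over `m` is then of the
  -- form `x^q - (-y)^q`.
  have h2 : ∀ m ∈ Finset.Icc 1 q,
      ∏ n ∈ Finset.Icc 1 q, (τ + zeta q ^ m * (ω * s₁) + zeta q ^ n * (ω * s₂)) =
      ∏ n ∈ Finset.Icc 1 q, (τ + zeta q ^ m * (ω * (s₁ + zeta q ^ n * s₂))) := by
    intro m _
    rw [← prod_Icc_zeta_shift_pow hq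
      (fun w => τ + zeta q ^ m * (ω * s₁) + w * (ω * s₂)) m]
    refine Finset.prod_congr rfl fun n _ => ?_
    ring
  rw [Finset.prod_congr rfl h2, Finset.prod_comm]
  refine Finset.prod_congr rfl fun n _ => ?_
  rw [prod_Icc_zeta_add hq, neg_pow, mul_pow]
  ring

/-! ### Differentials of branches of power maps -/

/-- Branches are defined through the reduced fraction; `a` and `b` are a common integer multiple of
its terms, possibly negative. -/
theorem IsPowerBranch.zpow_eq {ε : ℚ} {U : Set Vec} {Φ : Vec → Vec} (h : IsPowerBranch ε U Φ)
    {a b : ℤ} (hb : b ≠ 0) (hε : ε = (a : ℚ) / b) {v : Vec} (hv : v ∈ U) (i : Fin 3) :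
    Φ v i ^ b = v i ^ a := by
  obtain ⟨c, h1, h2⟩ := Rat.num_den_mk hb (hε.trans (Rat.divInt_eq_div a b).symm)
  have h3 := h.2.2.2 v hv i
  rw [← zpow_natCast] at h3
  rw [h1, h2, mul_comm c, mul_comm c, zpow_mul, zpow_mul, h3]

theorem ne_zero_of_zpow_eq {x y : ℂ} {r s : ℤ} (hs : s ≠ 0) (hy : y ≠ 0) (h : x ^ s = y ^ r) :
    x ≠ 0 := by
  rintro rfl
  rw [zero_zpow s hs] at h
  exact zpow_ne_zero r hy h.symm

/-- Logarithmic differentiation of `Φ_i^s = w_i^r`. -/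
theorem fderiv_apply_of_zpow_eq {Φ : Vec → Vec} {v : Vec} {r s : ℤ} (hs : s ≠ 0)
    (hd : DifferentiableAt ℂ Φ v) (hv : ∀ i, v i ≠ 0)
    (h : ∀ᶠ w in 𝓝 v, ∀ i, Φ w i ^ s = w i ^ r) (ξ : Vec) (i : Fin 3) :
    fderiv ℂ Φ v ξ i = (r / s : ℂ) * Φ v i * (ξ i / v i) := by
  have h0 := h.self_of_nhds i
  have hΦ : Φ v i ≠ 0 := ne_zero_of_zpow_eq hs (hv i) h0
  have e1 := (hasDerivAt_zpow s (Φ v i) (Or.inl hΦ)).comp_hasFDerivAt v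
    (hasFDerivAt_pi'.mp hd.hasFDerivAt i)
  have e2 := (hasDerivAt_zpow r (v i) (Or.inl (hv i))).comp_hasFDerivAt v
    (ContinuousLinearMap.proj (R := ℂ) (φ := fun _ : Fin 3 => ℂ) i).hasFDerivAt
  have e3 := e1.congr_of_eventuallyEq
    (f₁ := (fun x : ℂ => x ^ r) ∘ (ContinuousLinearMap.proj (R := ℂ) (φ := fun _ : Fin 3 => ℂ) i))
    (h.mono fun w hw => (hw i).symm)
  have e4 := congrArg (fun L => L ξ) (e3.unique e2)
  simp only [smul_apply, ContinuousLinearMap.comp_apply,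
    ContinuousLinearMap.proj_apply, smul_eq_mul, zpow_sub_one₀ hΦ, zpow_sub_one₀ (hv i), h0] at e4
  have hs' : (s : ℂ) ≠ 0 := by exact_mod_cast hs
  have h5 : v i ^ r ≠ 0 := zpow_ne_zero r (hv i)
  have hvi := hv i
  have e5 : v i ^ r * (s * (Φ v i)⁻¹ * fderiv ℂ Φ v ξ i) = v i ^ r * (r * (v i)⁻¹ * ξ i) := by
    linear_combination e4
  have e6 := mul_left_cancel₀ h5 e5
  field_simp at e6 ⊢
  linear_combination e6

/-- The factor of proportionality in `crossProduct_of_logDeriv`. -/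
def crossFactor (e : ℂ) (v u : Vec) : ℂ := e * (∏ i, u i) / ∏ i, v i

theorem crossFactor_ne_zero {e : ℂ} {v u : Vec} (he : e ≠ 0) (hv : ∀ i, v i ≠ 0)
    (hu : ∀ i, u i ≠ 0) : crossFactor e v u ≠ 0 :=
  div_ne_zero (mul_ne_zero he (Finset.prod_ne_zero_iff.mpr fun i _ => hu i))
    (Finset.prod_ne_zero_iff.mpr fun i _ => hv i)

/-- With `j = i + 1` and `k = i + 2`, the `i`-th component of `u × η` is `e u_j u_k (ξ_k/v_k -
ξ_j/v_j)`, that is `e (u_j u_k)/(v_j v_k)` times that of `v × ξ`. Only `v_i/u_i` depends on `i` once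
the full products are factored out. -/
theorem crossProduct_of_logDeriv {e : ℂ} {v u ξ η : Vec} (hv : ∀ i, v i ≠ 0) (hu : ∀ i, u i ≠ 0)
    (h : ∀ i, η i = e * u i * (ξ i / v i)) :
    crossProduct u η = fun i => crossFactor e v u * (v i / u i) * crossProduct v ξ i := by
  have v0 := hv 0
  have v1 := hv 1
  have v2 := hv 2
  have u0 := hu 0
  have u1 := hu 1
  have u2 := hu 2
  funext i
  simp only [crossFactor, cross_apply, h, Fin.prod_univ_three]
  fin_cases i <;> simp <;> field_simp

/-! ### Pull-backs by branches of `h_ε` -/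

theorem biEval_triWeb_branch {p : ℤ} {q : ℕ} (hq : 0 < q) {v u a : Vec} {κ : ℂ}
    (hu : ∀ i, u i ≠ 0) (h : ∀ i, u i ^ ((q : ℤ) - p) = v i ^ (q : ℤ)) :
    biEval (triWeb p q) u (fun i => κ * (v i / u i) * a i) =
      (powFactor p u * κ ^ q) ^ q * eval a (triProd q) := by
  rw [biEval_triWeb, eval_triProd_eq_triNorm hq, ← eval_triNorm_smul hq]
  congr 2
  funext i
  have h1 := h i
  have h2 : u i ^ p * (v i / u i) ^ q = 1 := by
    have h3 := zpow_ne_zero p (hu i)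
    have h4 := pow_ne_zero q (hu i)
    rw [zpow_sub₀ (hu i), zpow_natCast, zpow_natCast] at h1
    rw [div_pow, ← h1]
    field_simp
  rw [eval_powCoord p hu, mul_pow, mul_pow]
  linear_combination (powFactor p u * κ ^ q * a i ^ q) * h2

/-- The conormal factor relating `Leg 𝓕_{p/q}` and `Leg 𝔽_{p/q}` under a branch of `h_ε`. -/
def legFactor (p : ℤ) (q : ℕ) (κ : ℂ) (v u : Vec) : ℂ :=
  (powFactor p (fun i => κ * (v i / u i)) * κ ^ p) ^ q

theorem legFactor_ne_zero (p : ℤ) (q : ℕ) {κ : ℂ} (hκ : κ ≠ 0) {v u : Vec} (hv : ∀ i, v i ≠ 0)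
    (hu : ∀ i, u i ≠ 0) : legFactor p q κ v u ≠ 0 :=
  pow_ne_zero _ (mul_ne_zero
    (powFactor_ne_zero p fun i => mul_ne_zero hκ (div_ne_zero (hv i) (hu i))) (zpow_ne_zero _ hκ))

theorem eval_powCoord_legFactor {p : ℤ} {κ : ℂ} (hκ : κ ≠ 0) {v u : Vec} (hv : ∀ i, v i ≠ 0)
    (hu : ∀ i, u i ≠ 0) (a : Vec) (i : Fin 3) :
    eval (fun i => κ * (v i / u i) * a i) (powCoord p i) =
      powFactor p (fun i => κ * (v i / u i)) * κ ^ p * (v i ^ p / u i ^ p) *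
        eval a (powCoord p i) := by
  rw [eval_powCoord_mul p (D := fun i => κ * (v i / u i))
    (fun i => mul_ne_zero hκ (div_ne_zero (hv i) (hu i))), mul_zpow, div_zpow]
  ring

theorem biEval_leg_triWeb_branch {p : ℤ} {q : ℕ} (hq : 0 < q) {v u a : Vec} {κ : ℂ} (hκ : κ ≠ 0)
    (hv : ∀ i, v i ≠ 0) (hu : ∀ i, u i ≠ 0) (h : ∀ i, u i ^ (p - q) = v i ^ p) :
    biEval (leg (triWeb p q)) u (fun i => κ * (v i / u i) * a i) =
      legFactor p q κ v u * biEval (legCurve (triCurve p q)) v a := by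
  rw [biEval_leg, biEval_triWeb, biEval_legCurve, eval_triCurve, legFactor,
    ← eval_triNorm_smul hq]
  congr 2
  funext i
  rw [eval_powCoord_legFactor hκ hv hu]
  have h1 := h i
  have h2 : v i ^ p / u i ^ p * u i ^ q = 1 := by
    have h3 := zpow_ne_zero p (hu i)
    have h4 := pow_ne_zero q (hu i)
    rw [zpow_sub₀ (hu i), zpow_natCast] at h1
    rw [← h1]
    field_simp
  linear_combination (powFactor p (fun i => κ * (v i / u i)) * κ ^ p * eval a (powCoord p i)) * h2

/-- The inverse direction of `biEval_leg_triWeb_branch`: here the curve is upstairs, and the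
relation amounts to `(v_i/u_i)^p = v_i^q`. -/
theorem biEval_legCurve_branch {p : ℤ} {q : ℕ} (hq : 0 < q) {v u a : Vec} {κ : ℂ} (hκ : κ ≠ 0)
    (hv : ∀ i, v i ≠ 0) (hu : ∀ i, u i ≠ 0) (h : ∀ i, u i ^ p = v i ^ (p - q)) :
    biEval (legCurve (triCurve p q)) u (fun i => κ * (v i / u i) * a i) =
      legFactor p q κ v u * biEval (leg (triWeb p q)) v a := by
  rw [biEval_leg, biEval_triWeb, biEval_legCurve, eval_triCurve, legFactor,
    ← eval_triNorm_smul hq]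
  congr 2
  funext i
  rw [eval_powCoord_legFactor hκ hv hu]
  have h1 := h i
  have h2 : v i ^ p / u i ^ p = v i ^ q := by
    have h3 := zpow_ne_zero p (hv i)
    have h4 := pow_ne_zero q (hv i)
    rw [h1, zpow_sub₀ (hv i), zpow_natCast]
    field_simp
  rw [h2]
  ring

theorem differentiableOn_crossFactor (e : ℂ) {U : Set Vec} {Φ : Vec → Vec}
    (hU : ∀ v ∈ U, ∀ i, v i ≠ 0) (hd : DifferentiableOn ℂ Φ U) :
    DifferentiableOn ℂ (fun v => crossFactor e v (Φ v)) U := by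
  rw [differentiableOn_pi] at hd
  have h0 := hd 0
  have h1 := hd 1
  have h2 := hd 2
  simp only [crossFactor, Fin.prod_univ_three, div_eq_mul_inv]
  have h3 : DifferentiableOn ℂ (fun v => e * (Φ v 0 * Φ v 1 * Φ v 2)) U := by fun_prop
  have h4 : DifferentiableOn ℂ (fun v : Vec => v 0 * v 1 * v 2) U := by fun_prop
  refine h3.fun_mul (h4.fun_inv fun v hv => ?_)
  exact mul_ne_zero (mul_ne_zero (hU v hv 0) (hU v hv 1)) (hU v hv 2)

theorem differentiableOn_powFactor (p : ℤ) {U : Set Vec} {Φ : Vec → Vec}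
    (hd : ∀ i, DifferentiableOn ℂ (fun v => Φ v i) U) :
    DifferentiableOn ℂ (fun v => powFactor p (Φ v)) U := by
  have h0 := hd 0
  have h1 := hd 1
  have h2 := hd 2
  simp only [powFactor, Fin.prod_univ_three]
  fun_prop

theorem isPowerPullback_triWeb {p : ℤ} {q : ℕ} (hq : 0 < q) (hne : p ≠ q) {Q : BiPoly}
    (hQ : ∀ v a, biEval Q v a = eval a (triProd q)) :
    IsPowerPullback ((q : ℚ) / ((q : ℚ) - (p : ℚ))) (triWeb p q) Q := by
  intro U Φ hΦ
  have hs : (q : ℤ) - p ≠ 0 := sub_ne_zero.mpr (Ne.symm hne)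
  have hz : ∀ v ∈ U, ∀ i, Φ v i ^ ((q : ℤ) - p) = v i ^ (q : ℤ) := fun v hv i =>
    hΦ.zpow_eq hs (by push_cast; rfl) hv i
  obtain ⟨hU, hv0, hd, -⟩ := hΦ
  have hu0 : ∀ v ∈ U, ∀ i, Φ v i ≠ 0 := fun v hv i =>
    ne_zero_of_zpow_eq hs (hv0 v hv i) (hz v hv i)
  set e : ℂ := ((q : ℤ) : ℂ) / (((q : ℤ) - p : ℤ) : ℂ) with he
  have he0 : e ≠ 0 := div_ne_zero (by exact_mod_cast hq.ne') (by exact_mod_cast hs)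
  refine ⟨fun v => (powFactor p (Φ v) * crossFactor e v (Φ v) ^ q) ^ q, ?_, ?_, ?_⟩
  · have h1 := differentiableOn_crossFactor e hv0 hd
    have h2 := differentiableOn_powFactor p (differentiableOn_pi.mp hd)
    fun_prop
  · intro v hv
    exact pow_ne_zero _ (mul_ne_zero (powFactor_ne_zero p (hu0 v hv))
      (pow_ne_zero _ (crossFactor_ne_zero he0 (hv0 v hv) (hu0 v hv))))
  · intro v hv ξ
    have h1 := fderiv_apply_of_zpow_eq hs (hd.differentiableAt (hU.mem_nhds hv)) (hv0 v hv)
      (Filter.eventually_of_mem (hU.mem_nhds hv) hz) ξ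
    rw [form, form, hQ, crossProduct_of_logDeriv (hv0 v hv) (hu0 v hv) h1,
      biEval_triWeb_branch hq (hu0 v hv) (hz v hv)]

theorem isPowerPullback_leg_triWeb {p : ℤ} {q : ℕ} (hq : 0 < q) (hp : p ≠ 0) (hne : p ≠ q) :
    IsPowerPullback ((p : ℚ) / ((p : ℚ) - (q : ℚ))) (leg (triWeb p q))
      (legCurve (triCurve p q)) := by
  intro U Φ hΦ
  have hs : p - (q : ℤ) ≠ 0 := sub_ne_zero.mpr hne
  have hz : ∀ v ∈ U, ∀ i, Φ v i ^ (p - (q : ℤ)) = v i ^ p := fun v hv i =>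
    hΦ.zpow_eq hs (by push_cast; rfl) hv i
  obtain ⟨hU, hv0, hd, -⟩ := hΦ
  have hu0 : ∀ v ∈ U, ∀ i, Φ v i ≠ 0 := fun v hv i =>
    ne_zero_of_zpow_eq hs (hv0 v hv i) (hz v hv i)
  set e : ℂ := (p : ℂ) / ((p - (q : ℤ) : ℤ) : ℂ) with he
  have he0 : e ≠ 0 := div_ne_zero (by exact_mod_cast hp) (by exact_mod_cast hs)
  have hκ0 : ∀ v ∈ U, crossFactor e v (Φ v) ≠ 0 := fun v hv =>
    crossFactor_ne_zero he0 (hv0 v hv) (hu0 v hv)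
  refine ⟨fun v => legFactor p q (crossFactor e v (Φ v)) v (Φ v), ?_, ?_, ?_⟩
  · have h1 := differentiableOn_crossFactor e hv0 hd
    have h2 := differentiableOn_powFactor p (Φ := fun v i =>
      crossFactor e v (Φ v) * (v i / Φ v i)) (U := U) fun i => by
        have h3 : DifferentiableOn ℂ (fun v : Vec => v i) U := by fun_prop
        simp only [div_eq_mul_inv]
        exact h1.fun_mul (h3.fun_mul ((differentiableOn_pi.mp hd i).fun_inv fun v hv => hu0 v hv i))
    exact (h2.fun_mul (h1.zpow (Or.inl hκ0))).fun_pow q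
  · intro v hv
    exact legFactor_ne_zero p q (hκ0 v hv) (hv0 v hv) (hu0 v hv)
  · intro v hv ξ
    have h1 := fderiv_apply_of_zpow_eq hs (hd.differentiableAt (hU.mem_nhds hv)) (hv0 v hv)
      (Filter.eventually_of_mem (hU.mem_nhds hv) hz) ξ
    rw [form, form, crossProduct_of_logDeriv (hv0 v hv) (hu0 v hv) h1,
      biEval_leg_triWeb_branch hq (hκ0 v hv) (hv0 v hv) (hu0 v hv) (hz v hv)]

/-! ### Germs of biholomorphisms given by power maps -/

theorem eventually_forall_ne_zero {v : Vec} (hv : ∀ i, v i ≠ 0) : ∀ᶠ w in 𝓝 v, ∀ i, w i ≠ 0 :=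
  Filter.eventually_all.mpr fun i => (continuous_apply i).continuousAt.eventually_ne (hv i)

/-- A local branch of the multivalued map `h_{r/s}`. -/
theorem exists_analytic_branch {v : Vec} (hv : ∀ i, v i ≠ 0) (r : ℤ) {s : ℤ} (hs : s ≠ 0) :
    ∃ Φ : Vec → Vec, (∀ᶠ w in 𝓝 v, AnalyticAt ℂ Φ w) ∧
      ∀ᶠ w in 𝓝 v, ∀ i, Φ w i ^ s = w i ^ r := by
  have hs' : (s : ℂ) ≠ 0 := by exact_mod_cast hs
  have hc : ∀ z : ℂ, z ≠ 0 → Complex.exp (Complex.log z / s) ^ s = z := by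
    intro z hz
    rw [← Complex.exp_int_mul, mul_div_cancel₀ _ hs', Complex.exp_log hz]
  have han : ∀ᶠ w in 𝓝 v, ∀ i, w i / v i ∈ Complex.slitPlane := by
    refine Filter.eventually_all.mpr fun i => ?_
    refine ContinuousAt.eventually_mem ((continuous_apply i).continuousAt.div_const _) ?_
    rw [div_self (hv i)]
    exact Complex.isOpen_slitPlane.mem_nhds Complex.one_mem_slitPlane
  -- Near `v` the quotient `w i / v i` is close to `1`, so the principal logarithm is analytic there
  -- whatever the argument of `v i`; the constant factor restores the value at `v`.
  refine ⟨fun w i => Complex.exp (Complex.log (v i ^ r) / s) *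
    Complex.exp (r * Complex.log (w i / v i) / s), ?_, ?_⟩
  · filter_upwards [han] with w hw
    refine AnalyticAt.pi fun i => ?_
    refine analyticAt_const.mul (AnalyticAt.cexp (AnalyticAt.div_const (analyticAt_const.mul ?_)))
    have hp : AnalyticAt ℂ (fun w : Vec => w i) w :=
      (ContinuousLinearMap.proj (R := ℂ) (φ := fun _ : Fin 3 => ℂ) i).analyticAt w
    exact hp.div_const.clog (hw i)
  · filter_upwards [eventually_forall_ne_zero hv] with w hw i
    have h1 : w i / v i ≠ 0 := div_ne_zero (hw i) (hv i)
    rw [mul_zpow, hc _ (zpow_ne_zero r (hv i)), ← Complex.exp_int_mul, mul_div_cancel₀ _ hs',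
      Complex.exp_int_mul, Complex.exp_log h1, div_zpow, mul_div_cancel₀ _ (zpow_ne_zero r (hv i))]

/-- The equivalence must map the germ of `Leg 𝓕_{p/q}` to the algebraic web, hence the exponent `(p
- q)/p`, inverse to that of part (b). -/
theorem exists_germEquivBy {p : ℤ} {q : ℕ} (hq : 0 < q) (hp : p ≠ 0) (hne : p ≠ q) {v : Vec}
    (hv : ∀ i, v i ≠ 0) :
    ∃ Φ : Vec → Vec, (∀ i, Φ v i ^ p = v i ^ (p - q)) ∧
      GermEquivBy Φ (leg (triWeb p q)) (legCurve (triCurve p q)) v := by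
  obtain ⟨Φ, ha, hz⟩ := exists_analytic_branch hv (p - q) hp
  have hr : p - (q : ℤ) ≠ 0 := sub_ne_zero.mpr hne
  set e : ℂ := ((p - q : ℤ) : ℂ) / (p : ℂ) with he
  have he0 : e ≠ 0 := div_ne_zero (by exact_mod_cast hr) (by exact_mod_cast hp)
  have hd : ∀ᶠ w in 𝓝 v, (∀ i, w i ≠ 0) ∧ (∀ i, Φ w i ≠ 0) ∧
      ∀ ξ i, fderiv ℂ Φ w ξ i = e * Φ w i * (ξ i / w i) := by
    filter_upwards [ha, hz.eventually_nhds, eventually_forall_ne_zero hv] with w h1 h2 h3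
    exact ⟨h3, fun i => ne_zero_of_zpow_eq hp (h3 i) (h2.self_of_nhds i),
      fderiv_apply_of_zpow_eq hp h1.differentiableAt h3 h2⟩
  obtain ⟨-, hΦ, hdv⟩ := hd.self_of_nhds
  refine ⟨Φ, hz.self_of_nhds, ⟨fun h => hv 0 (congrFun h 0), fun h => hΦ 0 (congrFun h 0),
    ha.self_of_nhds, ?_, ?_⟩, fun w => legFactor p q (crossFactor e w (Φ w)) w (Φ w), ?_, ?_, ?_⟩
  · filter_upwards [hd] with w hw
    refine ⟨e, funext fun i => ?_⟩
    rw [hw.2.2, div_self (hw.1 i)]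
    simp
  · rintro ξ ⟨c, hc⟩
    refine ⟨c / e, funext fun i => ?_⟩
    have h1 := congrFun hc i
    rw [hdv, Pi.smul_apply, smul_eq_mul] at h1
    have h2 := hv i
    have h3 := hΦ i
    rw [Pi.smul_apply, smul_eq_mul]
    field_simp at h1 ⊢
    linear_combination h1
  · have hΦa : ∀ i, AnalyticAt ℂ (fun w => Φ w i) v := analyticAt_pi_iff.mp ha.self_of_nhds
    have hpa : ∀ i, AnalyticAt ℂ (fun w : Vec => w i) v := fun i =>
      (ContinuousLinearMap.proj (R := ℂ) (φ := fun _ : Fin 3 => ℂ) i).analyticAt v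
    have h1 : AnalyticAt ℂ (fun w => crossFactor e w (Φ w)) v := by
      simp only [crossFactor, Fin.prod_univ_three]
      exact (analyticAt_const.mul (((hΦa 0).mul (hΦa 1)).mul (hΦa 2))).div
        (((hpa 0).mul (hpa 1)).mul (hpa 2)) (mul_ne_zero (mul_ne_zero (hv 0) (hv 1)) (hv 2))
    have h2 : ∀ i, AnalyticAt ℂ (fun w => crossFactor e w (Φ w) * (w i / Φ w i)) v := fun i =>
      h1.mul ((hpa i).div (hΦa i) (hΦ i))
    simp only [legFactor, powFactor, Fin.prod_univ_three]
    exact (((((h2 0).mul (h2 1)).mul (h2 2)).pow _).mul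
      (h1.zpow (crossFactor_ne_zero he0 hv hΦ))).pow q
  · exact legFactor_ne_zero p q (crossFactor_ne_zero he0 hv hΦ) hv hΦ
  · filter_upwards [hd, hz] with w hw hzw ξ
    rw [form, form, crossProduct_of_logDeriv hw.1 hw.2.1 (hw.2.2 ξ),
      biEval_legCurve_branch hq (crossFactor_ne_zero he0 hw.1 hw.2.1) hw.1 hw.2.1 hzw]

/-! ### Reducedness of the curve `𝔽_{p/q}` -/

theorem polynomial_eval_aeval {σ : Type*} (t : ℂ) (g : σ → Polynomial ℂ) (φ : MvPolynomial σ ℂ) :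
    Polynomial.eval t (aeval g φ) = eval (fun i => (g i).eval t) φ := by
  induction φ using MvPolynomial.induction_on with
  | C a => simp
  | add P Q hP hQ => simp [hP, hQ]
  | mul_X P i hP => simp [hP]

theorem eval_eq_of_forall_ne_zero {f : Polynomial ℂ} (hf : ∀ t, f.eval t ≠ 0) (s t : ℂ) :
    f.eval s = f.eval t := by
  have h : f.degree = 0 := by
    by_contra h
    obtain ⟨z, hz⟩ := IsAlgClosed.exists_root f h
    exact hf z hz
  rw [Polynomial.eq_C_of_degree_eq_zero h]
  simp

/-- A polynomial in two variables without zeros outside the origin is constant. -/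
theorem isUnit_of_eval_eq_zero_imp {φ : MvPolynomial (Fin 2) ℂ}
    (h : ∀ x, eval x φ = 0 → x = 0) : IsUnit φ := by
  -- A line parallel to an axis and missing the origin carries a polynomial without zeros in one
  -- variable, hence a constant.
  have hX : ∀ b : ℂ, b ≠ 0 → ∀ s t, eval ![s, b] φ = eval ![t, b] φ := by
    intro b hb s t
    have h1 : ∀ t, eval ![t, b] φ = (aeval ![Polynomial.X, Polynomial.C b] φ).eval t := by
      intro t
      rw [polynomial_eval_aeval]
      congr 2
      funext i
      fin_cases i <;> simp
    rw [h1, h1]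
    refine eval_eq_of_forall_ne_zero (fun t ht => hb ?_) s t
    rw [← h1] at ht
    exact congrFun (h _ ht) 1
  have hY : ∀ a : ℂ, a ≠ 0 → ∀ s t, eval ![a, s] φ = eval ![a, t] φ := by
    intro a ha s t
    have h1 : ∀ t, eval ![a, t] φ = (aeval ![Polynomial.C a, Polynomial.X] φ).eval t := by
      intro t
      rw [polynomial_eval_aeval]
      congr 2
      funext i
      fin_cases i <;> simp
    rw [h1, h1]
    refine eval_eq_of_forall_ne_zero (fun t ht => ha ?_) s t
    rw [← h1] at ht
    exact congrFun (h _ ht) 0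
  have hc : eval ![1, 1] φ ≠ 0 := fun h0 => by simpa using congrFun (h _ h0) 0
  -- The monomial absorbs the axis `b = 0`, from which the two families of lines do not lead to `(1,
  -- 1)`.
  have h2 : (φ - C (eval ![1, 1] φ)) * (X 0 * X 1) = 0 := by
    refine MvPolynomial.funext fun x => ?_
    obtain ⟨a, b, rfl⟩ : ∃ a b, x = ![a, b] := ⟨x 0, x 1, by funext i; fin_cases i <;> rfl⟩
    simp only [map_mul, map_sub, eval_C, eval_X, map_zero, Matrix.cons_val_zero,
      Matrix.cons_val_one]
    by_cases hb : b = 0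
    · simp [hb]
    · rw [hX b hb a 1, hY 1 one_ne_zero b 1]
      simp
  have h3 : (X 0 * X 1 : MvPolynomial (Fin 2) ℂ) ≠ 0 := mul_ne_zero (X_ne_zero 0) (X_ne_zero 1)
  have h4 : φ = C (eval ![1, 1] φ) := sub_eq_zero.mp ((mul_eq_zero.mp h2).resolve_right h3)
  rw [h4]
  exact (isUnit_iff_ne_zero.mpr hc).map C

/-- The polynomial `T ↦ Q(T, x₀, x₁)`. -/
def specialize (Q : MvPolynomial (Fin 3) ℂ) (x : Fin 2 → ℂ) : Polynomial ℂ :=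
  (finSuccEquiv ℂ 2 Q).map (eval x)

theorem eval_specialize (Q : MvPolynomial (Fin 3) ℂ) (x : Fin 2 → ℂ) (t : ℂ) :
    (specialize Q x).eval t = eval ![t, x 0, x 1] Q := by
  rw [specialize, ← eval_eq_eval_mv_eval']
  congr 2
  funext i
  fin_cases i <;> rfl

theorem natDegree_finSuccEquiv_le {Q : MvPolynomial (Fin 3) ℂ} {N : ℕ}
    (h : ∀ x, (specialize Q x).natDegree ≤ N) : (finSuccEquiv ℂ 2 Q).natDegree ≤ N := by
  rw [Polynomial.natDegree_le_iff_coeff_eq_zero]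
  intro j hj
  refine MvPolynomial.funext fun x => ?_
  rw [map_zero, ← Polynomial.coeff_map]
  exact Polynomial.coeff_eq_zero_of_natDegree_lt ((h x).trans_lt hj)

/-- If `H² G = Q`, then `H` is a unit on the squarefree fibre over `x₀`, so `G` alone has degree `N`
there. As `Q` has degree at most `N` in the first variable, `H` has degree `0`. It is then a
polynomial in the other two variables, whose zeros would make a whole fibre vanish; by `h0` it has
none outside the origin, hence is constant. -/
theorem squarefree_of_specialize {Q : MvPolynomial (Fin 3) ℂ} {N : ℕ}
    (hle : ∀ x, (specialize Q x).natDegree ≤ N) {x₀ : Fin 2 → ℂ}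
    (hN : (specialize Q x₀).natDegree = N) (hsq : Squarefree (specialize Q x₀))
    (h0 : ∀ x, specialize Q x = 0 → x = 0) : Squarefree Q := by
  intro h hdvd
  have hF := natDegree_finSuccEquiv_le hle
  obtain ⟨g, hg⟩ := hdvd
  have hQ : Q ≠ 0 := by
    rintro rfl
    exact hsq.ne_zero (by simp [specialize])
  set H := finSuccEquiv ℂ 2 h with hH
  set G := finSuccEquiv ℂ 2 g with hG
  have e1 : finSuccEquiv ℂ 2 Q = H * H * G := by rw [hg, map_mul, map_mul]
  have hF0 : finSuccEquiv ℂ 2 Q ≠ 0 := by simpa using hQ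
  have e2 : specialize Q x₀ = H.map (eval x₀) * H.map (eval x₀) * G.map (eval x₀) := by
    rw [specialize, e1, Polynomial.map_mul, Polynomial.map_mul]
  have hu := hsq (H.map (eval x₀)) ⟨_, e2⟩
  have hd : (H.map (eval x₀)).natDegree = 0 := Polynomial.natDegree_eq_zero_of_isUnit hu
  have n0 := hsq.ne_zero
  rw [e2] at hN n0
  rw [e1] at hF hF0
  rw [Polynomial.natDegree_mul (left_ne_zero_of_mul n0) (right_ne_zero_of_mul n0),
    Polynomial.natDegree_mul hu.ne_zero hu.ne_zero, hd] at hN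
  have hH0 : H ≠ 0 := left_ne_zero_of_mul (left_ne_zero_of_mul hF0)
  rw [Polynomial.natDegree_mul (left_ne_zero_of_mul hF0) (right_ne_zero_of_mul hF0),
    Polynomial.natDegree_mul hH0 hH0] at hF
  have hGd : (G.map (eval x₀)).natDegree ≤ G.natDegree := Polynomial.natDegree_map_le
  have hHd : H.natDegree = 0 := by omega
  obtain ⟨φ, hφ⟩ : ∃ φ, H = Polynomial.C φ := ⟨_, Polynomial.eq_C_of_natDegree_eq_zero hHd⟩
  have hφu : IsUnit φ := isUnit_of_eval_eq_zero_imp fun x hx => h0 x <| by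
    rw [specialize, e1, hφ]
    simp [hx]
  have : IsUnit H := hφ ▸ hφu.map Polynomial.C
  exact (isUnit_map_iff (finSuccEquiv ℂ 2) h).mp this

/-- Only the zeros of finitely many nonzero polynomials in `σ` are to be avoided: the powers `(1 +
ζ^k X)^q` are pairwise distinct, since their linear coefficients `q ζ^k` are. -/
theorem exists_generic_scale {q : ℕ} (hq : 0 < q) : ∃ σ : ℂ, σ ≠ 0 ∧
    (∀ k ∈ Finset.Icc 1 q, 1 + zeta q ^ k * σ ≠ 0) ∧
    Set.InjOn (fun k => (1 + zeta q ^ k * σ) ^ q) (Finset.Icc 1 q : Finset ℕ) := by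
  classical
  let L : ℕ → Polynomial ℂ := fun k => 1 + Polynomial.C (zeta q ^ k) * Polynomial.X
  have hL : ∀ k z, (L k).eval z = 1 + zeta q ^ k * z := fun k z => by simp [L]
  have hL0 : ∀ k, L k ≠ 0 := fun k h => by simpa [h] using hL k 0
  have hD : ∀ k ∈ Finset.Icc 1 q, ∀ m ∈ (Finset.Icc 1 q).erase k, L k ^ q - L m ^ q ≠ 0 := by
    intro k hk m hm h
    obtain ⟨hmk, hm⟩ := Finset.mem_erase.mp hm
    have h1 := congrArg (fun P => (Polynomial.derivative P).eval 0) h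
    simp only [L, Polynomial.derivative_sub, Polynomial.derivative_pow, Polynomial.eval_sub] at h1
    simp only [map_add, Polynomial.derivative_one, Polynomial.derivative_C_mul,
      Polynomial.derivative_X, Polynomial.derivative_zero] at h1
    simp only [map_natCast, Polynomial.eval_mul, Polynomial.eval_natCast, Polynomial.eval_pow,
      Polynomial.eval_add, Polynomial.eval_one, Polynomial.eval_C, Polynomial.eval_X,
      Polynomial.eval_zero, mul_zero, add_zero, one_pow, mul_one, zero_add] at h1
    rw [← mul_sub, mul_eq_zero, sub_eq_zero] at h1
    rcases h1 with h1 | h1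
    · exact hq.ne' (by exact_mod_cast h1)
    · exact hmk (injOn_zeta_pow hq hm hk h1.symm)
  have hP : Polynomial.X * (∏ k ∈ Finset.Icc 1 q, L k) *
      (∏ k ∈ Finset.Icc 1 q, ∏ m ∈ (Finset.Icc 1 q).erase k, (L k ^ q - L m ^ q)) ≠ 0 :=
    mul_ne_zero (mul_ne_zero Polynomial.X_ne_zero (Finset.prod_ne_zero_iff.mpr fun k _ => hL0 k))
      (Finset.prod_ne_zero_iff.mpr fun k hk => Finset.prod_ne_zero_iff.mpr fun m hm => hD k hk m hm)
  obtain ⟨σ, hσ⟩ : ∃ σ, Polynomial.eval σ (Polynomial.X * (∏ k ∈ Finset.Icc 1 q, L k) *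
      (∏ k ∈ Finset.Icc 1 q, ∏ m ∈ (Finset.Icc 1 q).erase k, (L k ^ q - L m ^ q))) ≠ 0 := by
    by_contra! h
    exact hP (Polynomial.funext fun σ => by rw [h, Polynomial.eval_zero])
  simp only [Polynomial.eval_mul, Polynomial.eval_X, Polynomial.eval_prod, Polynomial.eval_sub,
    Polynomial.eval_pow, hL, ne_eq, mul_eq_zero, not_or, Finset.prod_eq_zero_iff, not_exists,
    not_and] at hσ
  refine ⟨σ, hσ.1.1, hσ.1.2, fun k hk m hm hkm => ?_⟩
  by_contra hne
  exact hσ.2 k hk m (Finset.mem_erase.mpr ⟨fun h => hne h.symm, hm⟩) (sub_eq_zero.mpr hkm)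

theorem squarefree_prod_X_pow_sub_C {ι : Type*} (s : Finset ι) {n : ℕ} (hn : n ≠ 0) {l : ι → ℂ}
    (h0 : ∀ k ∈ s, l k ≠ 0) (hl : Set.InjOn l s) :
    Squarefree (∏ k ∈ s, (Polynomial.X ^ n - Polynomial.C (l k))) := by
  refine (Polynomial.separable_prod' (fun j hj k hk hjk => ?_) fun k hk => ?_).squarefree
  · have h : l k - l j ≠ 0 := sub_ne_zero.mpr fun h => hjk (hl hj hk h.symm)
    refine ⟨Polynomial.C (l k - l j)⁻¹, -Polynomial.C (l k - l j)⁻¹, ?_⟩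
    have h2 : Polynomial.C (l k - l j)⁻¹ * (Polynomial.C (l k) - Polynomial.C (l j)) = 1 := by
      rw [← Polynomial.C_sub, ← Polynomial.C_mul, inv_mul_cancel₀ h, Polynomial.C_1]
    linear_combination h2
  · exact Polynomial.separable_X_pow_sub_C _ (by exact_mod_cast hn) (h0 k hk)

theorem natDegree_prod_X_pow_sub_C {ι : Type*} (s : Finset ι) (n : ℕ) (l : ι → ℂ) :
    (∏ k ∈ s, (Polynomial.X ^ n - Polynomial.C (l k))).natDegree = n * s.card := by
  by_cases hn : n = 0
  · subst hn
    rw [zero_mul, ← le_zero_iff]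
    refine (Polynomial.natDegree_prod_le _ _).trans (le_of_eq (Finset.sum_eq_zero fun k _ => ?_))
    rw [pow_zero, ← Polynomial.C_1, ← Polynomial.C_sub, Polynomial.natDegree_C]
  · rw [Polynomial.natDegree_prod_of_monic _ _ fun k _ => Polynomial.monic_X_pow_sub_C _ hn]
    simp [mul_comm]

theorem prod_C_sub_C_mul_X_pow {ι : Type*} (s : Finset ι) (n : ℕ) {A : ℂ} {l : ι → ℂ}
    (h0 : ∀ k ∈ s, l k ≠ 0) :
    ∏ k ∈ s, (Polynomial.C A - Polynomial.C (l k) * Polynomial.X ^ n) =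
      Polynomial.C (∏ k ∈ s, -l k) * ∏ k ∈ s, (Polynomial.X ^ n - Polynomial.C (A / l k)) := by
  rw [map_prod, ← Finset.prod_mul_distrib]
  refine Finset.prod_congr rfl fun k hk => ?_
  rw [mul_sub, ← Polynomial.C_mul, neg_mul, mul_div_cancel₀ _ (h0 k hk), Polynomial.C_neg,
    Polynomial.C_neg]
  ring

theorem natDegree_prod_C_sub_C_mul_X_pow {ι : Type*} (s : Finset ι) (n : ℕ) {A : ℂ} {l : ι → ℂ}
    (h0 : ∀ k ∈ s, l k ≠ 0) :
    (∏ k ∈ s, (Polynomial.C A - Polynomial.C (l k) * Polynomial.X ^ n)).natDegree =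
      n * s.card := by
  rw [prod_C_sub_C_mul_X_pow s n h0, Polynomial.natDegree_C_mul
    (Finset.prod_ne_zero_iff.mpr fun k hk => neg_ne_zero.mpr (h0 k hk)),
    natDegree_prod_X_pow_sub_C]

theorem squarefree_prod_C_sub_C_mul_X_pow {ι : Type*} (s : Finset ι) {n : ℕ} (hn : n ≠ 0) {A : ℂ}
    (hA : A ≠ 0) {l : ι → ℂ} (h0 : ∀ k ∈ s, l k ≠ 0) (hl : Set.InjOn l s) :
    Squarefree (∏ k ∈ s, (Polynomial.C A - Polynomial.C (l k) * Polynomial.X ^ n)) := by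
  rw [prod_C_sub_C_mul_X_pow s n h0]
  have hu : IsUnit (Polynomial.C (∏ k ∈ s, -l k)) := Polynomial.isUnit_C.mpr
    (Finset.prod_ne_zero_iff.mpr fun k hk => neg_ne_zero.mpr (h0 k hk)).isUnit
  have h1 := squarefree_prod_X_pow_sub_C s hn (l := fun k => A / l k)
    (fun k hk => div_ne_zero hA (h0 k hk)) fun k hk m hm hkm => hl hk hm <| by
      simp only [div_eq_mul_inv] at hkm
      exact inv_injective (mul_left_cancel₀ hA hkm)
  exact fun x hx => h1 x (hu.dvd_mul_left.mp hx)

theorem specialize_triCurve_of_pos {n q : ℕ} (hq : 0 < q) (s₁ s₂ : ℂ) :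
    specialize (triCurve n q) ![s₁ ^ q, s₂ ^ q] = ∏ k ∈ Finset.Icc 1 q,
      (Polynomial.X ^ n - Polynomial.C ((-1) ^ q * (s₁ ^ n + zeta q ^ k * s₂ ^ n) ^ q)) := by
  refine Polynomial.funext fun t => ?_
  rw [eval_specialize, eval_triCurve]
  have h : (fun i => eval ![t, (![s₁ ^ q, s₂ ^ q] : Fin 2 → ℂ) 0, (![s₁ ^ q, s₂ ^ q] : Fin 2 → ℂ) 1]
      (powCoord n i)) = ![t ^ n, 1 * (s₁ ^ n) ^ q, 1 * (s₂ ^ n) ^ q] := by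
    funext i
    fin_cases i <;> simp [powCoord] <;> ring
  rw [h, eval_triNorm_eq_prod hq]
  simp [Polynomial.eval_prod]

/-- The three arguments of `N` are `(yz)^n, (zx)^n, (xy)^n`; the variable `T = x` now enters the
last two, so `eval_triNorm_eq_prod` is used with `W = T^n`. The leading coefficient depends on the
fibre and may vanish. -/
theorem specialize_triCurve_of_neg {n q : ℕ} (hn : n ≠ 0) (hq : 0 < q) (s₁ s₂ : ℂ) :
    specialize (triCurve (-n) q) ![s₁ ^ q, s₂ ^ q] = ∏ k ∈ Finset.Icc 1 q,
      (Polynomial.C ((s₁ * s₂) ^ (n * q)) -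
        Polynomial.C ((-1) ^ q * (s₂ ^ n + zeta q ^ k * s₁ ^ n) ^ q) * Polynomial.X ^ n) := by
  refine Polynomial.funext fun t => ?_
  rw [eval_specialize, eval_triCurve]
  have h : (fun i => eval ![t, (![s₁ ^ q, s₂ ^ q] : Fin 2 → ℂ) 0, (![s₁ ^ q, s₂ ^ q] : Fin 2 → ℂ) 1]
      (powCoord (-n) i)) =
      ![(s₁ * s₂) ^ (n * q), t ^ n * (s₂ ^ n) ^ q, t ^ n * (s₁ ^ n) ^ q] := by
    funext i
    fin_cases i <;> simp [powCoord, hn] <;> ring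
  rw [h, eval_triNorm_eq_prod hq]
  simp [Polynomial.eval_prod]

theorem exists_eq_pow {q : ℕ} (hq : 0 < q) (x : Fin 2 → ℂ) :
    ∃ s₁ s₂ : ℂ, x = ![s₁ ^ q, s₂ ^ q] := by
  obtain ⟨s₁, h1⟩ := IsAlgClosed.exists_pow_nat_eq (x 0) hq
  obtain ⟨s₂, h2⟩ := IsAlgClosed.exists_pow_nat_eq (x 1) hq
  exact ⟨s₁, s₂, by funext i; fin_cases i <;> simp [h1, h2]⟩

theorem neg_one_pow_complex_ne_zero (q : ℕ) : ((-1) ^ q : ℂ) ≠ 0 := pow_ne_zero _ (by norm_num)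

theorem squarefree_triCurve_of_pos {n q : ℕ} (hn : n ≠ 0) (hq : 0 < q) :
    Squarefree (triCurve n q) := by
  obtain ⟨σ, hσ0, hσ1, hσ2⟩ := exists_generic_scale hq
  have hsign := neg_one_pow_complex_ne_zero q
  obtain ⟨s, hs⟩ := IsAlgClosed.exists_pow_nat_eq σ (Nat.pos_of_ne_zero hn)
  -- Since `s^n = σ`, the constants of the binomials on this fibre are `± (1 + ζ^k σ)^q`, nonzero
  -- and distinct by the choice of `σ`.
  refine squarefree_of_specialize (N := n * q) (x₀ := ![1 ^ q, s ^ q]) ?_ ?_ ?_ ?_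
  · intro x
    obtain ⟨s₁, s₂, rfl⟩ := exists_eq_pow hq x
    rw [specialize_triCurve_of_pos hq, natDegree_prod_X_pow_sub_C]
    simp
  · rw [specialize_triCurve_of_pos hq, natDegree_prod_X_pow_sub_C]
    simp
  · rw [specialize_triCurve_of_pos hq]
    refine squarefree_prod_X_pow_sub_C _ hn (fun k hk => ?_) fun k hk m hm hkm => ?_
    · rw [one_pow, hs]
      exact mul_ne_zero hsign (pow_ne_zero _ (hσ1 k hk))
    · simp only [one_pow, hs] at hkm
      exact hσ2 hk hm (mul_left_cancel₀ hsign hkm)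
  · intro x hx
    obtain ⟨s₁, s₂, rfl⟩ := exists_eq_pow hq x
    rw [specialize_triCurve_of_pos hq] at hx
    exact absurd hx (Finset.prod_ne_zero_iff.mpr fun k _ =>
      (Polynomial.monic_X_pow_sub_C _ hn).ne_zero)

theorem squarefree_triCurve_of_neg {n q : ℕ} (hn : n ≠ 0) (hq : 0 < q) :
    Squarefree (triCurve (-n) q) := by
  obtain ⟨σ, hσ0, hσ1, hσ2⟩ := exists_generic_scale hq
  have hsign := neg_one_pow_complex_ne_zero q
  obtain ⟨s, hs⟩ := IsAlgClosed.exists_pow_nat_eq σ (Nat.pos_of_ne_zero hn)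
  have hκ : ∀ k ∈ Finset.Icc 1 q, (-1) ^ q * (1 + zeta q ^ k * σ) ^ q ≠ 0 := fun k hk =>
    mul_ne_zero hsign (pow_ne_zero _ (hσ1 k hk))
  have hinj : Set.InjOn (fun k => (-1) ^ q * (1 + zeta q ^ k * σ) ^ q)
      (Finset.Icc 1 q : Finset ℕ) := fun k hk m hm hkm =>
    hσ2 hk hm (mul_left_cancel₀ hsign hkm)
  have hfac : specialize (triCurve (-n) q) ![s ^ q, 1 ^ q] = ∏ k ∈ Finset.Icc 1 q,
      (Polynomial.C (s ^ (n * q)) -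
        Polynomial.C ((-1) ^ q * (1 + zeta q ^ k * σ) ^ q) * Polynomial.X ^ n) := by
    rw [specialize_triCurve_of_neg hn hq]
    simp only [mul_one, one_pow, hs]
  have hs0 : s ^ (n * q) ≠ 0 := by
    rw [pow_mul, hs]
    exact pow_ne_zero q hσ0
  refine squarefree_of_specialize (N := n * q) (x₀ := ![s ^ q, 1 ^ q]) ?_ ?_ ?_ ?_
  · intro x
    obtain ⟨s₁, s₂, rfl⟩ := exists_eq_pow hq x
    rw [specialize_triCurve_of_neg hn hq]
    refine (Polynomial.natDegree_prod_le _ _).trans ?_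
    refine (Finset.sum_le_card_nsmul _ _ n fun k _ => ?_).trans (by simp [mul_comm])
    refine (Polynomial.natDegree_sub_le _ _).trans ?_
    rw [Polynomial.natDegree_C]
    exact max_le (Nat.zero_le _) (Polynomial.natDegree_C_mul_X_pow_le _ _)
  · rw [hfac, natDegree_prod_C_sub_C_mul_X_pow _ _ hκ]
    simp
  · rw [hfac]
    exact squarefree_prod_C_sub_C_mul_X_pow _ hn hs0 hκ hinj
  · intro x hx
    obtain ⟨s₁, s₂, rfl⟩ := exists_eq_pow hq x
    rw [specialize_triCurve_of_neg hn hq] at hx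
    obtain ⟨k, hk, h⟩ := Finset.prod_eq_zero_iff.mp hx
    -- The values at `0` and `1` give the vanishing of both coefficients of the binomial: the first
    -- forces `s₁ s₂ = 0`, the second then makes the other one vanish too.
    have h1 := congrArg (fun P => Polynomial.eval 0 P) h
    have h2 := congrArg (fun P => Polynomial.eval 1 P) h
    have hz : zeta q ≠ 0 := Complex.exp_ne_zero _
    simp only [Polynomial.eval_sub, Polynomial.eval_mul, Polynomial.eval_C, Polynomial.eval_pow,
      Polynomial.eval_X, Polynomial.eval_zero, zero_pow hn, mul_zero, sub_zero, one_pow] at h1 h2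
    rw [h1, zero_sub, mul_one, neg_eq_zero, mul_eq_zero, or_iff_right hsign,
      pow_eq_zero_iff hq.ne'] at h2
    rw [pow_eq_zero_iff (mul_ne_zero hn hq.ne')] at h1
    have : s₁ = 0 ∧ s₂ = 0 := by
      rcases mul_eq_zero.mp h1 with rfl | rfl
      · simpa [hn] using h2
      · simpa [hn, hz] using h2
    obtain ⟨rfl, rfl⟩ := this
    funext i
    fin_cases i <;> simp [hq.ne']

theorem squarefree_triCurve {p : ℤ} {q : ℕ} (hp : p ≠ 0) (hq : 0 < q) :
    Squarefree (triCurve p q) := by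
  obtain ⟨n, rfl | rfl⟩ := p.eq_nat_or_neg
  · exact squarefree_triCurve_of_pos (by exact_mod_cast hp) hq
  · exact squarefree_triCurve_of_neg (by simpa using hp) hq

theorem squarefree_triProd {q : ℕ} (hq : 0 < q) : Squarefree (triProd q) := by
  rw [← triCurve_self hq]
  exact squarefree_triCurve (by exact_mod_cast hq.ne') hq

/-! ### Discriminants and a line transversal to a reduced curve -/

/-- A discriminant of polynomials of formal degree `k`, which also vanishes when the degree
is less than `k`. -/
def sepDisc {R : Type*} [CommRing R] (k : ℕ) (f : Polynomial R) : R :=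
  f.coeff k * f.resultant (Polynomial.derivative f) k k

theorem sepDisc_map {R S : Type*} [CommRing R] [CommRing S] (φ : R →+* S) (k : ℕ)
    (f : Polynomial R) : sepDisc k (f.map φ) = φ (sepDisc k f) := by
  rw [sepDisc, sepDisc, map_mul, Polynomial.coeff_map, Polynomial.derivative_map,
    Polynomial.resultant_map_map]

theorem sepDisc_ne_zero_iff {K : Type*} [Field K] {k : ℕ} {f : Polynomial K}
    (hf : f.natDegree ≤ k) : sepDisc k f ≠ 0 ↔ f.natDegree = k ∧ f.Separable := by
  have hg : (Polynomial.derivative f).natDegree ≤ k :=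
    (Polynomial.natDegree_derivative_le f).trans ((Nat.sub_le _ _).trans hf)
  have key : f.natDegree = k → f ≠ 0 →
      (f.resultant (Polynomial.derivative f) k k ≠ 0 ↔ f.Separable) := by
    intro hk h0
    obtain ⟨j, hj⟩ := Nat.exists_eq_add_of_le hg
    have hc : f.coeff k ≠ 0 := by rw [← hk]; simpa using h0
    -- Raising the formal degree of the derivative to `k` only costs powers of the leading
    -- coefficient of `f`.
    have h1 : f.resultant (Polynomial.derivative f) k k =
        f.coeff k ^ j * f.resultant (Polynomial.derivative f) := by
      conv_lhs => rw [show f.resultant (Polynomial.derivative f) k k =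
        f.resultant (Polynomial.derivative f) k ((Polynomial.derivative f).natDegree + j) by
          rw [← hj]]
      rw [Polynomial.resultant_add_right_deg _ _ _ _ _ le_rfl, hk]
    rw [h1, mul_ne_zero_iff, and_iff_right (pow_ne_zero _ hc), ne_eq,
      Polynomial.resultant_eq_zero_iff, Polynomial.Separable]
    simp [h0]
  constructor
  · intro h
    have hc : f.coeff k ≠ 0 := left_ne_zero_of_mul h
    have hk : f.natDegree = k := le_antisymm hf (Polynomial.le_natDegree_of_ne_zero hc)
    have h0 : f ≠ 0 := by rintro rfl; simp at hc
    exact ⟨hk, (key hk h0).mp (right_ne_zero_of_mul h)⟩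
  · rintro ⟨hk, hs⟩
    refine mul_ne_zero ?_ ((key hk hs.ne_zero).mpr hs)
    rw [← hk]
    simpa using hs.ne_zero

theorem squarefree_of_isUnit_mul {M : Type*} [CommMonoid M] {u x : M} (hu : IsUnit u)
    (hx : Squarefree x) : Squarefree (u * x) :=
  fun y hy => hx y (hu.dvd_mul_left.mp hy)

/-- A form of Gauss's lemma: over an integrally closed domain, a factor over `K` of a monic
polynomial is, up to a constant, the image of a monic polynomial over `A`, so a square factor
descends. -/
theorem squarefree_map_fractionRing {A K : Type*} [CommRing A] [IsDomain A] [IsIntegrallyClosed A]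
    [Field K] [Algebra A K] [IsFractionRing A K] {f : Polynomial A} (hf : IsUnit f.leadingCoeff)
    (hsq : Squarefree f) : Squarefree (f.map (algebraMap A K)) := by
  have hinj : Function.Injective (algebraMap A K) := IsFractionRing.injective A K
  obtain ⟨u, hu⟩ := hf
  set M : Polynomial A := Polynomial.C (↑u⁻¹ : A) * f with hM
  have hfM : f = Polynomial.C (↑u : A) * M := by
    rw [hM, ← mul_assoc, ← Polynomial.C_mul, Units.mul_inv, Polynomial.C_1, one_mul]
  have hMm : M.Monic := by
    rw [Polynomial.Monic, hM, Polynomial.leadingCoeff_mul, Polynomial.leadingCoeff_C, ← hu,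
      Units.inv_mul]
  have hMs : Squarefree M := squarefree_of_isUnit_mul (u⁻¹.isUnit.map Polynomial.C) hsq
  have hMK : Squarefree (M.map (algebraMap A K)) := by
    intro h hdvd
    have hM0 : M.map (algebraMap A K) ≠ 0 := (hMm.map _).ne_zero
    have hh0 : h ≠ 0 := by
      rintro rfl
      rw [zero_mul, zero_dvd_iff] at hdvd
      exact hM0 hdvd
    obtain ⟨g, hg⟩ := IsIntegrallyClosed.eq_map_mul_C_of_dvd K hMm
      ((dvd_mul_right h h).trans hdvd)
    have hlc : h.leadingCoeff ≠ 0 := by simpa using hh0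
    have hgm : g.Monic := by
      have h1 := congrArg Polynomial.leadingCoeff hg
      rw [Polynomial.leadingCoeff_mul, Polynomial.leadingCoeff_C,
        Polynomial.leadingCoeff_map_of_injective hinj] at h1
      have h2 : algebraMap A K g.leadingCoeff = 1 := by
        apply mul_right_cancel₀ hlc
        rw [h1, one_mul]
      exact hinj (by rw [h2, map_one])
    have hgg : g * g ∣ M := by
      rw [← Polynomial.map_dvd_map (algebraMap A K) hinj (hgm.mul hgm), Polynomial.map_mul]
      refine dvd_trans (mul_dvd_mul ?_ ?_) hdvd <;> exact ⟨_, hg.symm⟩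
    have hg1 : IsUnit g := hMs g hgg
    rw [← hg]
    exact (hg1.map (Polynomial.mapRingHom (algebraMap A K))).mul
      (Polynomial.isUnit_C.mpr hlc.isUnit)
  rw [hfM, Polynomial.map_mul, Polynomial.map_C]
  exact squarefree_of_isUnit_mul (Polynomial.isUnit_C.mpr (u.isUnit.map (algebraMap A K))) hMK

/-- The shear `(X₀, X₁, X₂) ↦ (X₀, X₁ + a X₀, X₂ + b X₀)`. -/
def shear (a b : ℂ) : MvPolynomial (Fin 3) ℂ →ₐ[ℂ] MvPolynomial (Fin 3) ℂ :=
  bind₁ ![X 0, X 1 + C a * X 0, X 2 + C b * X 0]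

theorem shear_shear (a b : ℂ) (Q : MvPolynomial (Fin 3) ℂ) : shear a b (shear (-a) (-b) Q) = Q := by
  rw [← AlgHom.comp_apply]
  conv_rhs => rw [← AlgHom.id_apply (R := ℂ) Q]
  congr 1
  ext1 i
  fin_cases i <;> simp [shear]

theorem squarefree_shear {Q : MvPolynomial (Fin 3) ℂ} (hQ : Squarefree Q) (a b : ℂ) :
    Squarefree (shear a b Q) := by
  intro h hh
  have h1 := map_dvd (shear (-a) (-b)) hh
  have h2 : shear (-a) (-b) (shear a b Q) = Q := by simpa using shear_shear (-a) (-b) Q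
  rw [h2, map_mul] at h1
  have h3 := (hQ _ h1).map (shear a b)
  rwa [shear_shear] at h3

theorem isHomogeneous_shear {Q : MvPolynomial (Fin 3) ℂ} {k : ℕ} (hQ : Q.IsHomogeneous k)
    (a b : ℂ) : (shear a b Q).IsHomogeneous k := by
  rw [← mul_one k]
  refine isWeightedHomogeneous_bind₁ hQ fun i => ?_
  change IsHomogeneous _ 1
  fin_cases i
  · exact isHomogeneous_X ℂ 0
  · exact (isHomogeneous_X ℂ 1).add (isHomogeneous_C_mul_X a 0)
  · exact (isHomogeneous_X ℂ 2).add (isHomogeneous_C_mul_X b 0)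

theorem eval_shear (a b : ℂ) (Q : MvPolynomial (Fin 3) ℂ) (y : Vec) :
    eval y (shear a b Q) = eval ![y 0, y 1 + a * y 0, y 2 + b * y 0] Q := by
  rw [shear, eval_bind₁_eq]
  congr 2
  funext i
  fin_cases i <;> simp

theorem exists_eval_ne_zero {σ : Type*} {φ : MvPolynomial σ ℂ} (h : φ ≠ 0) :
    ∃ x, eval x φ ≠ 0 := by
  by_contra! h'
  exact h (MvPolynomial.funext fun x => by rw [h', map_zero])

/-- The restriction of `Q` to the line through `b` and `b'`. -/
def restrictLine (Q : MvPolynomial (Fin 3) ℂ) (b b' : Vec) : Polynomial ℂ :=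
  aeval (fun i => Polynomial.C (b i) + Polynomial.C (b' i) * Polynomial.X) Q

theorem eval_restrictLine (Q : MvPolynomial (Fin 3) ℂ) (b b' : Vec) (t : ℂ) :
    (restrictLine Q b b').eval t = eval (b + t • b') Q := by
  rw [restrictLine, polynomial_eval_aeval]
  congr 2
  funext i
  rw [Polynomial.eval_add, Polynomial.eval_mul, Polynomial.eval_C, Polynomial.eval_C,
    Polynomial.eval_X, Pi.add_apply, Pi.smul_apply, smul_eq_mul, mul_comm]

/-- Some line meets a reduced curve transversally. -/
theorem exists_separable_restrictLine {Q : MvPolynomial (Fin 3) ℂ} {k : ℕ}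
    (hQ : Q.IsHomogeneous k) (hsq : Squarefree Q) :
    ∃ a b x y : ℂ, x ≠ 0 ∧ (restrictLine Q ![0, x, y] ![1, a, b]).natDegree = k ∧
      (restrictLine Q ![0, x, y] ![1, a, b]).Separable := by
  -- The lines considered pass through a point `(1 : a : b)` off the curve. The shear moves it to
  -- `(1 : 0 : 0)`, so that `Q'` has degree `k` in the first variable, with constant leading
  -- coefficient.
  obtain ⟨z, hz⟩ := exists_eval_ne_zero (mul_ne_zero (X_ne_zero (R := ℂ) (0 : Fin 3)) hsq.ne_zero)
  rw [map_mul, eval_X] at hz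
  have hz0 : z 0 ≠ 0 := left_ne_zero_of_mul hz
  set a := z 1 / z 0 with ha
  set b := z 2 / z 0 with hb
  have hab : eval ![1, a, b] Q ≠ 0 := by
    have h1 := eval_smul_of_isHomogeneous hQ (z 0) ![1, a, b]
    have h2 : (fun i => z 0 * (![1, a, b] : Vec) i) = z := by
      funext i
      fin_cases i <;> simp [ha, hb] <;> field_simp
    rw [h2] at h1
    exact right_ne_zero_of_mul (h1 ▸ right_ne_zero_of_mul hz)
  set Q' := shear a b Q with hQ'
  have hh : Q'.IsHomogeneous k := isHomogeneous_shear hQ a b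
  set F := finSuccEquiv ℂ 2 Q' with hF
  have hdeg : F.natDegree ≤ k := by
    rw [hF, natDegree_finSuccEquiv]
    exact (degreeOf_le_totalDegree _ _).trans hh.totalDegree_le
  obtain ⟨c, hc⟩ : ∃ c, F.coeff k = C c :=
    ⟨_, totalDegree_eq_zero_iff_eq_C.mp
      ((totalDegree_zero_iff_isHomogeneous _).mpr (hh.finSuccEquiv_coeff_isHomogeneous k 0 rfl))⟩
  have hspec : ∀ x, specialize Q' x = restrictLine Q ![0, x 0, x 1] ![1, a, b] := by
    intro x
    refine Polynomial.funext fun t => ?_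
    rw [eval_specialize, eval_shear, eval_restrictLine]
    congr 2
    funext i
    fin_cases i <;> simp [mul_comm]
  have hc0 : c ≠ 0 := by
    rintro rfl
    have h1 : specialize Q' 0 = Polynomial.C (eval ![1, a, b] Q) * Polynomial.X ^ k := by
      refine Polynomial.funext fun t => ?_
      rw [hspec, eval_restrictLine, Polynomial.eval_mul, Polynomial.eval_C, Polynomial.eval_pow,
        Polynomial.eval_X, mul_comm, ← eval_smul_of_isHomogeneous hQ]
      congr 2
      funext i
      fin_cases i <;> simp
    have h2 := congrArg (fun f => Polynomial.coeff f k) h1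
    simp only [specialize, Polynomial.coeff_map, Polynomial.coeff_C_mul, ← hF, hc] at h2
    exact hab (by simpa using h2.symm)
  have hdeg' : F.natDegree = k := le_antisymm hdeg
    (Polynomial.le_natDegree_of_ne_zero (by rw [hc]; simpa using hc0))
  have hlc : IsUnit F.leadingCoeff := by
    rw [Polynomial.leadingCoeff, hdeg', hc]
    exact hc0.isUnit.map C
  have hFsq : Squarefree F := by
    intro h hdvd
    have h1 := map_dvd (finSuccEquiv ℂ 2).symm hdvd
    rw [hF, AlgEquiv.symm_apply_apply, map_mul] at h1
    exact (isUnit_map_iff (finSuccEquiv ℂ 2).symm h).mp (squarefree_shear hsq a b _ h1)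
  -- In characteristic zero squarefree means separable over the fraction field, so the discriminant
  -- is a nonzero polynomial in the parameters `x` of the lines.
  have hdisc : sepDisc k F ≠ 0 := by
    let K := FractionRing (MvPolynomial (Fin 2) ℂ)
    have hinj : Function.Injective (algebraMap (MvPolynomial (Fin 2) ℂ) K) :=
      IsFractionRing.injective _ K
    have : CharZero K := charZero_of_injective_algebraMap hinj
    have h1 := (sepDisc_ne_zero_iff (k := k) (f := F.map (algebraMap _ K))
      (by rw [Polynomial.natDegree_map_eq_of_injective hinj, hdeg'])).mpr
      ⟨by rw [Polynomial.natDegree_map_eq_of_injective hinj, hdeg'],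
        PerfectField.separable_iff_squarefree.mpr (squarefree_map_fractionRing hlc hFsq)⟩
    rw [sepDisc_map] at h1
    exact fun h => h1 (by rw [h, map_zero])
  -- The condition `x 0 ≠ 0` serves to divide by it in `exists_separableAt_legCurve`.
  obtain ⟨x, hx⟩ := exists_eval_ne_zero (mul_ne_zero (X_ne_zero (R := ℂ) (0 : Fin 2)) hdisc)
  rw [map_mul, eval_X, ← sepDisc_map] at hx
  have h1 := (sepDisc_ne_zero_iff (Polynomial.natDegree_map_le.trans hdeg)).mp
    (right_ne_zero_of_mul hx)
  refine ⟨a, b, x 0, x 1, left_ne_zero_of_mul hx, ?_⟩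
  rw [← hspec]
  exact h1

/-! ### Regularity of a web, read on a pencil of lines -/

theorem eval_weight_smul {σ : Type*} [Fintype σ] {w : σ → ℕ} {φ : MvPolynomial σ ℂ} {n : ℕ}
    (hφ : IsWeightedHomogeneous w φ n) (c : ℂ) (x : σ → ℂ) :
    eval (fun i => c ^ w i * x i) φ = c ^ n * eval x φ := by
  rw [eval_eq', eval_eq', Finset.mul_sum]
  refine Finset.sum_congr rfl fun e he => ?_
  have h : ∑ i, w i * e i = n := by
    rw [← hφ (mem_support_iff.mp he), Finsupp.weight_apply, Finsupp.sum_fintype _ _ (by simp)]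
    simp [mul_comm]
  simp only [mul_pow, ← pow_mul, Finset.prod_mul_distrib, Finset.prod_pow_eq_pow_sum, h]
  ring

theorem natDegree_aeval_le {σ R : Type*} [CommRing R] [Algebra ℂ R] {w : σ → ℕ}
    {φ : MvPolynomial σ ℂ} {n : ℕ} (hφ : IsWeightedHomogeneous w φ n) {g : σ → Polynomial R}
    (hg : ∀ i, (g i).natDegree ≤ w i) : (aeval g φ).natDegree ≤ n := by
  rw [φ.as_sum, map_sum]
  refine Polynomial.natDegree_sum_le_of_forall_le _ _ fun e he => ?_
  rw [aeval_monomial, Polynomial.algebraMap_apply]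
  refine (Polynomial.natDegree_C_mul_le _ _).trans ((Polynomial.natDegree_prod_le _ _).trans ?_)
  rw [← hφ (mem_support_iff.mp he), Finsupp.weight_apply]
  exact Finset.sum_le_sum fun i _ => Polynomial.natDegree_pow_le.trans
    (Nat.mul_le_mul_left _ (hg i))

theorem biEval_smul {P : BiPoly} {d k : ℕ} (hP : IsBihomogeneous P d k) (r s : ℂ) (v a : Vec) :
    biEval P (r • v) (s • a) = r ^ d * s ^ k * biEval P v a := by
  rw [mul_assoc, biEval, biEval, ← eval_weight_smul hP.2 s, ← eval_weight_smul hP.1 r]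
  congr 2
  funext j
  rcases j with j | j <;> simp

theorem biEval_smul_right {P : BiPoly} {d k : ℕ} (hP : IsBihomogeneous P d k) (s : ℂ)
    (v a : Vec) : biEval P v (s • a) = s ^ k * biEval P v a := by
  simpa using biEval_smul hP 1 s v a

/-- The polynomial `T ↦ P(v; v × c + T (v × c'))`, with coefficients in a `ℂ`-algebra: the
restriction of the web to the pencil of lines through `v`. -/
def restrictPencil {R : Type*} [CommRing R] [Algebra ℂ R] (P : BiPoly) (v c c' : Fin 3 → R) :
    Polynomial R :=
  aeval (Sum.elim (fun i => Polynomial.C (v i)) fun i =>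
    Polynomial.C (crossProduct v c i) + Polynomial.C (crossProduct v c' i) * Polynomial.X) P

theorem natDegree_restrictPencil_le {R : Type*} [CommRing R] [Algebra ℂ R] {P : BiPoly} {d k : ℕ}
    (hP : IsBihomogeneous P d k) (v c c' : Fin 3 → R) : (restrictPencil P v c c').natDegree ≤ k := by
  refine natDegree_aeval_le hP.2 fun j => ?_
  rcases j with j | j
  · simp
  · simp only [Sum.elim_inr]
    rw [add_comm]
    exact Polynomial.natDegree_linear_le

theorem eval_restrictPencil (P : BiPoly) (v c c' : Vec) (t : ℂ) :
    (restrictPencil P v c c').eval t =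
      biEval P v (crossProduct v c + t • crossProduct v c') := by
  rw [restrictPencil, polynomial_eval_aeval, biEval]
  congr 2
  funext j
  rcases j with j | j
  · simp only [Sum.elim_inl, Polynomial.eval_C]
  · rw [Sum.elim_inr, Sum.elim_inr, Polynomial.eval_add, Polynomial.eval_mul, Polynomial.eval_C,
      Polynomial.eval_C, Polynomial.eval_X, Pi.add_apply, Pi.smul_apply, smul_eq_mul, mul_comm t]

theorem map_restrictPencil (P : BiPoly) (c c' v : Vec) :
    (restrictPencil P (X : Fin 3 → MvPolynomial (Fin 3) ℂ) (fun i => C (c i))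
      (fun i => C (c' i))).map (eval v) = restrictPencil P v c c' := by
  refine Polynomial.funext fun t => ?_
  have h : ∀ φ : BiPoly, ∀ g : Fin 3 ⊕ Fin 3 → Polynomial (MvPolynomial (Fin 3) ℂ),
      (aeval g φ).map (eval v) = aeval (fun j => (g j).map (eval v)) φ := by
    intro φ g
    induction φ using MvPolynomial.induction_on with
    | C a => simp [Polynomial.algebraMap_apply, MvPolynomial.algebraMap_eq]
    | add P Q hP hQ => simp [hP, hQ]
    | mul_X P i hP => simp [hP]
  rw [restrictPencil, restrictPencil, h]
  congr 3
  funext j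
  rcases j with j | j
  · simp
  · fin_cases j <;> simp [cross_apply]

/-- The web `P` is regular at `v`, as is visible on the basis `v × c, v × c'` of the space of
lines through `v`. -/
def SeparableAt (P : BiPoly) (k : ℕ) (v c c' : Vec) : Prop :=
  v ⬝ᵥ crossProduct c c' ≠ 0 ∧ (restrictPencil P v c c').natDegree = k ∧
    (restrictPencil P v c c').Separable

/-- The line `v × c'` is the parameter `T = ∞`. Exchanging `c` and `c'` reverses the coefficients in
formal degree `k`, and the value at `0` of the reversed polynomial is the coefficient of `T^k`. -/
theorem biEval_cross_eq_coeff {P : BiPoly} {d k : ℕ} (hP : IsBihomogeneous P d k) (v c c' : Vec) :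
    biEval P v (crossProduct v c') = (restrictPencil P v c c').coeff k := by
  set f := restrictPencil P v c c' with hf
  have hle : f.natDegree ≤ k := natDegree_restrictPencil_le hP v c c'
  set g : Polynomial ℂ := aeval (Sum.elim (fun i => Polynomial.C (v i)) fun i =>
    Polynomial.C (crossProduct v c' i) + Polynomial.C (crossProduct v c i) * Polynomial.X) P with hg
  have hgt : ∀ s, g.eval s = biEval P v (crossProduct v c' + s • crossProduct v c) := by
    intro s
    rw [hg, polynomial_eval_aeval, biEval]
    congr 2
    funext j
    rcases j with j | j
    · simp only [Sum.elim_inl, Polynomial.eval_C]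
    · rw [Sum.elim_inr, Sum.elim_inr, Polynomial.eval_add, Polynomial.eval_mul, Polynomial.eval_C,
        Polynomial.eval_C, Polynomial.eval_X, Pi.add_apply, Pi.smul_apply, smul_eq_mul, mul_comm s]
  -- The factor `X` takes care of `s = 0`, where the substitution `s⁻¹` is not available.
  have h1 : Polynomial.X * g = Polynomial.X * f.reflect k := by
    refine Polynomial.funext fun s => ?_
    rw [Polynomial.eval_mul, Polynomial.eval_mul, Polynomial.eval_X]
    by_cases hs : s = 0
    · simp [hs]
    · let := invertibleOfNonzero (inv_ne_zero hs)
      have h2 := Polynomial.eval₂_reflect_mul_pow (RingHom.id ℂ) s⁻¹ k f hle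
      have h3 : crossProduct v c' + s • crossProduct v c =
          s • (crossProduct v c + s⁻¹ • crossProduct v c') := by
        rw [smul_add, smul_smul, mul_inv_cancel₀ hs, one_smul, add_comm]
      rw [hgt, h3, biEval_smul_right hP, ← eval_restrictPencil, ← hf]
      rw [invOf_eq_inv, inv_inv, inv_pow, Polynomial.eval₂_id, Polynomial.eval₂_id] at h2
      rw [← h2]
      field_simp
  have h4 := congrArg (Polynomial.eval 0) (mul_left_cancel₀ Polynomial.X_ne_zero h1)
  rw [hgt, ← Polynomial.coeff_zero_eq_eval_zero, Polynomial.coeff_reflect] at h4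
  simpa using h4

/-- Cramer's rule: the expansion of `a` along `c × c'`, `v × c`, `v × c'`, whose first coefficient
is `a ⬝ᵥ v`. -/
theorem dot_smul_eq (v c c' a : Vec) (ha : a ⬝ᵥ v = 0) :
    (v ⬝ᵥ crossProduct c c') • a =
      (a ⬝ᵥ c') • crossProduct v c - (a ⬝ᵥ c) • crossProduct v c' := by
  have h : (v ⬝ᵥ crossProduct c c') • a = (a ⬝ᵥ v) • crossProduct c c' +
      (a ⬝ᵥ c') • crossProduct v c - (a ⬝ᵥ c) • crossProduct v c' := by
    funext i
    simp only [cross_apply, dotProduct, Fin.sum_univ_three, Pi.smul_apply, Pi.sub_apply,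
      Pi.add_apply, smul_eq_mul]
    fin_cases i <;> simp <;> ring
  rw [h, ha, zero_smul, zero_add]

/-- The tangent lines at `v` correspond to the roots of the restricted polynomial through `t ↦ v × c
+ t (v × c')`; the missing line `v × c'` is not tangent because the degree is exactly `k`. -/
theorem SeparableAt.regularAt {P : BiPoly} {d k : ℕ} (hP : IsBihomogeneous P d k) {v c c' : Vec}
    (h : SeparableAt P k v c c') : RegularAt P k v := by
  obtain ⟨hΔ, hdeg, hsep⟩ := h
  set f := restrictPencil P v c c' with hf
  set Δ := v ⬝ᵥ crossProduct c c' with hΔd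
  refine ⟨fun hv => hΔ (by simp [hΔd, hv]), ?_⟩
  let ℓ : ℂ → Vec := fun t => crossProduct v c + t • crossProduct v c'
  have hfe : ∀ t, f.eval t = biEval P v (ℓ t) := eval_restrictPencil P v c c'
  have hd1 : ∀ t, ℓ t ⬝ᵥ c' = Δ := by
    intro t
    simp only [ℓ, hΔd, cross_apply, dotProduct, Fin.sum_univ_three, Pi.smul_apply, Pi.add_apply,
      smul_eq_mul]
    simp
    ring
  have hd2 : ∀ t, ℓ t ⬝ᵥ c = -(t * Δ) := by
    intro t
    simp only [ℓ, hΔd, cross_apply, dotProduct, Fin.sum_univ_three, Pi.smul_apply, Pi.add_apply,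
      smul_eq_mul]
    simp
    ring
  have hdv : ∀ t, ℓ t ⬝ᵥ v = 0 := by
    intro t
    simp only [ℓ, cross_apply, dotProduct, Fin.sum_univ_three, Pi.smul_apply, Pi.add_apply,
      smul_eq_mul]
    simp
    ring
  have hℓ0 : ∀ t, ℓ t ≠ 0 := fun t h0 => hΔ (by rw [← hd1 t, h0, zero_dotProduct])
  let m : ℂ → Projectivization ℂ Vec := fun t => Projectivization.mk ℂ (ℓ t) (hℓ0 t)
  have hinj : Function.Injective m := by
    intro s t hst
    obtain ⟨r, hr⟩ := (Projectivization.mk_eq_mk_iff' ℂ _ _ (hℓ0 s) (hℓ0 t)).mp hst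
    have h1 := congrArg (fun a => a ⬝ᵥ c') hr
    have h2 := congrArg (fun a => a ⬝ᵥ c) hr
    simp only [smul_dotProduct, hd1, hd2, smul_eq_mul] at h1 h2
    have h3 : r = 1 := mul_right_cancel₀ hΔ (by rw [h1, one_mul])
    rw [h3, one_mul, neg_inj] at h2
    exact (mul_right_cancel₀ hΔ h2).symm
  have hset : {a : Projectivization ℂ Vec | a.rep ⬝ᵥ v = 0 ∧ biEval P v a.rep = 0} =
      m '' (f.roots.toFinset : Set ℂ) := by
    ext a
    simp only [Set.mem_ofPred_eq, Set.mem_image, Finset.mem_coe, Multiset.mem_toFinset,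
      Polynomial.mem_roots hsep.ne_zero, Polynomial.IsRoot.def]
    constructor
    · rintro ⟨hav, ha⟩
      have h1 := dot_smul_eq v c c' a.rep hav
      rw [← hΔd] at h1
      have hs : a.rep ⬝ᵥ c' ≠ 0 := by
        intro hs
        rw [hs, zero_smul, zero_sub, ← neg_smul] at h1
        have h2 := biEval_smul_right hP Δ v a.rep
        rw [h1, biEval_smul_right hP, biEval_cross_eq_coeff hP v c c', ha, mul_zero] at h2
        have h3 : f.coeff k ≠ 0 := by
          rw [← hdeg]
          simpa using hsep.ne_zero
        have h4 := eq_zero_of_pow_eq_zero ((mul_eq_zero.mp h2).resolve_right h3)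
        rw [h4, zero_smul] at h1
        exact a.rep_nonzero ((smul_eq_zero.mp h1).resolve_left hΔ)
      have h2 : Δ • a.rep = (a.rep ⬝ᵥ c') • ℓ (-(a.rep ⬝ᵥ c) / (a.rep ⬝ᵥ c')) := by
        rw [h1, smul_add, smul_smul, mul_div_cancel₀ _ hs, neg_smul, sub_eq_add_neg]
      refine ⟨-(a.rep ⬝ᵥ c) / (a.rep ⬝ᵥ c'), ?_, ?_⟩
      · have h3 := biEval_smul_right hP Δ v a.rep
        rw [h2, biEval_smul_right hP, ha, mul_zero, ← hfe] at h3
        exact (mul_eq_zero.mp h3).resolve_left (pow_ne_zero _ hs)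
      · conv_rhs => rw [← a.mk_rep]
        refine (Projectivization.mk_eq_mk_iff' ℂ _ _ (hℓ0 _) a.rep_nonzero).mpr
          ⟨(a.rep ⬝ᵥ c')⁻¹ * Δ, ?_⟩
        rw [mul_smul, h2, smul_smul, inv_mul_cancel₀ hs, one_smul]
    · rintro ⟨t, ht, rfl⟩
      obtain ⟨r, hr⟩ := Projectivization.exists_smul_eq_mk_rep ℂ (ℓ t) (hℓ0 t)
      rw [← hr, Units.smul_def, smul_dotProduct, hdv, smul_zero, biEval_smul_right hP, ← hfe, ht,
        mul_zero]
      exact ⟨rfl, rfl⟩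
  rw [hset, hinj.encard_image, Set.encard_coe_eq_coe_finsetCard,
    Multiset.toFinset_card_of_nodup (Polynomial.nodup_roots hsep),
    IsAlgClosed.card_roots_eq_natDegree, hdeg]

theorem SeparableAt.of_biEval_eq {P Q : BiPoly} {k : ℕ} {u v c c' d d' : Vec} {L : ℂ}
    (h : SeparableAt P k u c c') (hL : L ≠ 0) (hd : v ⬝ᵥ crossProduct d d' ≠ 0)
    (heq : ∀ t : ℂ, biEval P u (crossProduct u c + t • crossProduct u c') =
      L * biEval Q v (crossProduct v d + t • crossProduct v d')) : SeparableAt Q k v d d' := by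
  have h1 : restrictPencil P u c c' = Polynomial.C L * restrictPencil Q v d d' :=
    Polynomial.funext fun t => by
      rw [Polynomial.eval_mul, Polynomial.eval_C, eval_restrictPencil, eval_restrictPencil, heq]
  obtain ⟨-, h2, h3⟩ := h
  rw [h1] at h2 h3
  rw [Polynomial.natDegree_C_mul hL] at h2
  exact ⟨hd, h2, h3.of_mul_right⟩

theorem SeparableAt.of_smul {P : BiPoly} {d k : ℕ} (hP : IsBihomogeneous P d k) {r : ℂ}
    (hr : r ≠ 0) {v c c' : Vec} (h : SeparableAt P k (r • v) c c') : SeparableAt P k v c c' := by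
  refine h.of_biEval_eq (L := r ^ d * r ^ k)
    (mul_ne_zero (pow_ne_zero _ hr) (pow_ne_zero _ hr)) (fun h0 => h.1 ?_) fun t => ?_
  · rw [smul_dotProduct, h0, smul_zero]
  · rw [← biEval_smul hP]
    congr 1
    simp only [map_smul, LinearMap.smul_apply, smul_add]
    rw [smul_comm r t]

/-- Regularity spreads to the complement of a hypersurface. -/
theorem SeparableAt.exists_generic {P : BiPoly} {d k : ℕ} (hP : IsBihomogeneous P d k)
    {v₀ c c' : Vec} (h : SeparableAt P k v₀ c c') : ∃ G : MvPolynomial (Fin 3) ℂ, G ≠ 0 ∧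
      ∀ v, eval v G ≠ 0 → SeparableAt P k v c c' := by
  -- The discriminant is taken with `v` generic, its coordinates being the variables; it specializes
  -- to that of each point, so `G` vanishes exactly where `SeparableAt` fails.
  set G : MvPolynomial (Fin 3) ℂ := (∑ i, C (crossProduct c c' i) * X i) *
    sepDisc k (restrictPencil P (X : Fin 3 → MvPolynomial (Fin 3) ℂ) (fun i => C (c i))
      (fun i => C (c' i))) with hG
  have hev : ∀ v, eval v G =
      (v ⬝ᵥ crossProduct c c') * sepDisc k (restrictPencil P v c c') := by
    intro v
    rw [hG, map_mul, ← sepDisc_map, map_restrictPencil]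
    congr 1
    rw [dotProduct_comm, dotProduct, map_sum]
    exact Finset.sum_congr rfl fun i _ => by rw [map_mul, eval_C, eval_X]
  have hiff : ∀ v, eval v G ≠ 0 ↔ SeparableAt P k v c c' := by
    intro v
    rw [hev, mul_ne_zero_iff, sepDisc_ne_zero_iff (natDegree_restrictPencil_le hP v c c'),
      SeparableAt]
  refine ⟨G, fun h0 => (hiff v₀).mpr h ?_, fun v => (hiff v).mp⟩
  rw [h0, map_zero]

/-- Any nonzero homogeneous component of `G` will do: where it does not vanish, `r ↦ G(r v)` is a
nonzero polynomial. Regularity being invariant under scaling, this yields the curve to be excluded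
in `IsAlgebraizable`. -/
theorem exists_isHomogeneous_of_ne_zero {G : MvPolynomial (Fin 3) ℂ} (hG : G ≠ 0) :
    ∃ (e : ℕ) (D : MvPolynomial (Fin 3) ℂ), D.IsHomogeneous e ∧ D ≠ 0 ∧
      ∀ v : Vec, eval v D ≠ 0 → ∃ r : ℂ, r ≠ 0 ∧ eval (r • v) G ≠ 0 := by
  obtain ⟨e, he, hD⟩ : ∃ e ∈ Finset.range (G.totalDegree + 1), homogeneousComponent e G ≠ 0 := by
    by_contra! h
    exact hG (by rw [← sum_homogeneousComponent G, Finset.sum_eq_zero h])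
  refine ⟨e, _, homogeneousComponent_isHomogeneous e G, hD, fun v hv => ?_⟩
  set f : Polynomial ℂ := ∑ j ∈ Finset.range (G.totalDegree + 1),
    Polynomial.C (eval v (homogeneousComponent j G)) * Polynomial.X ^ j with hf
  have hfe : ∀ r, f.eval r = eval (r • v) G := by
    intro r
    conv_rhs => rw [← sum_homogeneousComponent G]
    rw [hf, Polynomial.eval_finsetSum, map_sum]
    refine Finset.sum_congr rfl fun j _ => ?_
    have h1 : eval (r • v) (homogeneousComponent j G) =
        r ^ j * eval v (homogeneousComponent j G) :=
      eval_smul_of_isHomogeneous (homogeneousComponent_isHomogeneous j G) r v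
    rw [h1, Polynomial.eval_mul, Polynomial.eval_C, Polynomial.eval_pow, Polynomial.eval_X,
      mul_comm]
  have hf0 : f ≠ 0 := by
    intro h0
    have h1 := congrArg (fun g => Polynomial.coeff g e) h0
    simp only [hf, Polynomial.finsetSum_coeff, Polynomial.coeff_C_mul, Polynomial.coeff_X_pow,
      Polynomial.coeff_zero, mul_ite, mul_one, mul_zero, Finset.sum_ite_eq, he, if_true] at h1
    exact hv h1
  have h2 : Polynomial.X * f ≠ 0 := mul_ne_zero Polynomial.X_ne_zero hf0
  by_contra! h
  refine h2 (Polynomial.funext fun r => ?_)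
  rw [Polynomial.eval_mul, Polynomial.eval_X, Polynomial.eval_zero, hfe]
  by_cases hr : r = 0
  · rw [hr, zero_mul]
  · rw [h r hr, mul_zero]

theorem isBihomogeneous_legCurve {Q : MvPolynomial (Fin 3) ℂ} {k : ℕ} (hQ : Q.IsHomogeneous k) :
    IsBihomogeneous (legCurve Q) 0 k := by
  have h : legCurve Q = bind₁ (fun i => X (Sum.inr i)) Q := by
    rw [legCurve, leg, rename_rename]
    refine DFunLike.congr_fun (F := MvPolynomial (Fin 3) ℂ →ₐ[ℂ] BiPoly) ?_ Q
    ext1 i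
    simp
  rw [h]
  refine ⟨?_, ?_⟩
  · simpa using isWeightedHomogeneous_bind₁ (m := 0) hQ
      fun i => isWeightedHomogeneous_X ℂ _ (Sum.inr i)
  · simpa using isWeightedHomogeneous_bind₁ (m := 1) hQ
      fun i => isWeightedHomogeneous_X ℂ _ (Sum.inr i)

theorem exists_separableAt_legCurve {Q : MvPolynomial (Fin 3) ℂ} {k : ℕ}
    (hQ : Q.IsHomogeneous k) (hsq : Squarefree Q) :
    ∃ v c c' : Vec, SeparableAt (legCurve Q) k v c c' := by
  obtain ⟨a, b, x, y, hx, hdeg, hsep⟩ := exists_separable_restrictLine hQ hsq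
  -- The transversal line, as a point of the dual plane; the other two vectors are solutions of `v ×
  -- c = (0, x, y)` and `v × c' = (1, a, b)`.
  refine ⟨crossProduct ![0, x, y] ![1, a, b], ![-1, 0, 0], ![-(a / x), 1 / x, 0], ?_⟩
  have h1 : crossProduct (crossProduct ![0, x, y] ![1, a, b]) ![-1, 0, 0] = ![0, x, y] := by
    simp only [cross_apply]
    funext i
    fin_cases i <;> simp
  have h2 : crossProduct (crossProduct ![0, x, y] ![1, a, b]) ![-(a / x), 1 / x, 0] =
      ![1, a, b] := by
    simp only [cross_apply]
    funext i
    fin_cases i <;> simp <;> field_simp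
    ring
  have h3 : restrictPencil (legCurve Q) (crossProduct ![0, x, y] ![1, a, b]) ![-1, 0, 0]
      ![-(a / x), 1 / x, 0] = restrictLine Q ![0, x, y] ![1, a, b] :=
    Polynomial.funext fun t => by
      rw [eval_restrictPencil, eval_restrictLine, biEval_legCurve, h1, h2]
  refine ⟨?_, ?_, ?_⟩
  · rw [triple_product_permutation, triple_product_permutation, dotProduct_comm]
    simp [cross_apply, dotProduct, Fin.sum_univ_three, hx]
  · rw [h3, hdeg]
  · rw [h3]
    exact hsep

/-! ### Transfer of regularity between `Leg 𝔽_{p/q}` and `Leg 𝓕_{p/q}` -/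

theorem crossProduct_mul_div {u v : Vec} (hv : ∀ i, v i ≠ 0) (hu : ∀ i, u i ≠ 0) (c : Vec) :
    crossProduct u (fun i => u i * (c i / v i)) =
      fun i => crossFactor 1 v u * (v i / u i) * crossProduct v c i :=
  crossProduct_of_logDeriv hv hu fun i => by rw [one_mul]

theorem dot_crossProduct_mul_div {u v : Vec} (hv : ∀ i, v i ≠ 0)
    (c c' : Vec) : u ⬝ᵥ crossProduct (fun i => u i * (c i / v i)) (fun i => u i * (c' i / v i)) =
      crossFactor 1 v u * (v ⬝ᵥ crossProduct c c') := by
  have v0 := hv 0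
  have v1 := hv 1
  have v2 := hv 2
  simp only [crossFactor, cross_apply, dotProduct, Fin.prod_univ_three, Fin.sum_univ_three]
  simp
  field_simp

theorem biEval_legCurve_mul_div {p : ℤ} {q : ℕ} (hq : 0 < q) {v u : Vec} (hv : ∀ i, v i ≠ 0)
    (hu : ∀ i, u i ≠ 0) (h : ∀ i, u i ^ p = v i ^ (p - q)) (c c' : Vec) (t : ℂ) :
    biEval (legCurve (triCurve p q)) u (crossProduct u (fun i => u i * (c i / v i)) +
        t • crossProduct u (fun i => u i * (c' i / v i))) =
      legFactor p q (crossFactor 1 v u) v u *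
        biEval (leg (triWeb p q)) v (crossProduct v c + t • crossProduct v c') := by
  rw [← biEval_legCurve_branch hq (crossFactor_ne_zero one_ne_zero hv hu) hv hu h]
  congr 1
  rw [crossProduct_mul_div hv hu, crossProduct_mul_div hv hu]
  funext i
  simp only [Pi.add_apply, Pi.smul_apply, smul_eq_mul]
  ring

theorem SeparableAt.legCurve_of_leg {p : ℤ} {q k : ℕ} (hq : 0 < q) {v u c c' : Vec}
    (hv : ∀ i, v i ≠ 0) (hu : ∀ i, u i ≠ 0) (h : ∀ i, u i ^ p = v i ^ (p - q))
    (hs : SeparableAt (leg (triWeb p q)) k v c c') :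
    SeparableAt (legCurve (triCurve p q)) k u (fun i => u i * (c i / v i))
      (fun i => u i * (c' i / v i)) := by
  have hκ := crossFactor_ne_zero one_ne_zero hv hu
  have hL := legFactor_ne_zero p q hκ hv hu
  refine hs.of_biEval_eq (inv_ne_zero hL) ?_ fun t => ?_
  · rw [dot_crossProduct_mul_div hv]
    exact mul_ne_zero hκ hs.1
  · rw [biEval_legCurve_mul_div hq hv hu h, inv_mul_cancel_left₀ hL]

theorem SeparableAt.leg_of_legCurve {p : ℤ} {q k : ℕ} (hq : 0 < q) {v u c c' : Vec}
    (hv : ∀ i, v i ≠ 0) (hu : ∀ i, u i ≠ 0) (h : ∀ i, u i ^ p = v i ^ (p - q))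
    (hs : SeparableAt (legCurve (triCurve p q)) k u c c') :
    SeparableAt (leg (triWeb p q)) k v (fun i => v i * (c i / u i))
      (fun i => v i * (c' i / u i)) := by
  have hκ := crossFactor_ne_zero one_ne_zero hu hv
  have hL := legFactor_ne_zero p q (crossFactor_ne_zero one_ne_zero hv hu) hv hu
  have hc : ∀ c : Vec, (fun i => u i * (v i * (c i / u i) / v i)) = c := fun c => by
    funext i
    rw [mul_div_cancel_left₀ _ (hv i), mul_div_cancel₀ _ (hu i)]
  refine hs.of_biEval_eq hL ?_ fun t => ?_
  · rw [dot_crossProduct_mul_div hu]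
    exact mul_ne_zero hκ hs.1
  · rw [← biEval_legCurve_mul_div hq hv hu h, hc, hc]

theorem exists_zpow_eq {n : ℤ} (hn : n ≠ 0) {y : ℂ} (hy : y ≠ 0) : ∃ z : ℂ, z ≠ 0 ∧ z ^ n = y := by
  refine ⟨Complex.exp (Complex.log y / n), Complex.exp_ne_zero _, ?_⟩
  rw [← Complex.exp_int_mul, mul_div_cancel₀ _ (by exact_mod_cast hn), Complex.exp_log hy]

theorem ne_zero_of_eval_mul_prod_ne_zero {G : MvPolynomial (Fin 3) ℂ} {v : Vec}
    (h : eval v (G * ∏ i, X i) ≠ 0) : eval v G ≠ 0 ∧ ∀ i, v i ≠ 0 := by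
  rw [map_mul, map_prod, mul_ne_zero_iff, Finset.prod_ne_zero_iff] at h
  exact ⟨h.1, fun i => by simpa using h.2 i (Finset.mem_univ i)⟩

theorem mul_prod_X_ne_zero {G : MvPolynomial (Fin 3) ℂ} (hG : G ≠ 0) : G * ∏ i, X i ≠ 0 :=
  mul_ne_zero hG (Finset.prod_ne_zero_iff.mpr fun i _ => X_ne_zero i)

/-- A line transversal to the reduced curve can be moved off the coordinate axes of the dual plane,
since transversality is generic; solving `v_i^{p-q} = u_i^p` then carries it to the web. -/
theorem exists_separableAt_leg_triWeb {p : ℤ} {q : ℕ} (hq : 0 < q) (hp : p ≠ 0) (hne : p ≠ q) :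
    ∃ v c c' : Vec, SeparableAt (leg (triWeb p q)) (triDegree p q) v c c' := by
  have hC := isHomogeneous_triCurve p hq
  rw [mul_powDegree hp] at hC
  obtain ⟨u₀, c, c', h0⟩ := exists_separableAt_legCurve hC (squarefree_triCurve hp hq)
  obtain ⟨G, hG, hGs⟩ := h0.exists_generic (isBihomogeneous_legCurve hC)
  obtain ⟨u, hu⟩ := exists_eval_ne_zero (mul_prod_X_ne_zero hG)
  obtain ⟨hu, hu0⟩ := ne_zero_of_eval_mul_prod_ne_zero hu
  choose v hv0 hv using fun i => exists_zpow_eq (sub_ne_zero.mpr hne) (zpow_ne_zero p (hu0 i))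
  exact ⟨v, _, _, (hGs u hu).leg_of_legCurve hq hv0 hu0 fun i => (hv i).symm⟩

theorem isAlgebraizable_leg_triWeb {p : ℤ} {q : ℕ} (hq : 0 < q) (hp : p ≠ 0) (hne : p ≠ q) :
    IsAlgebraizable (leg (triWeb p q)) (triDegree p q) := by
  obtain ⟨v₀, c, c', h0⟩ := exists_separableAt_leg_triWeb hq hp hne
  have hP := isBihomogeneous_leg_triWeb p hq
  have hC := isHomogeneous_triCurve p hq
  rw [mul_powDegree hp] at hP hC
  obtain ⟨G, hG, hGs⟩ := h0.exists_generic hP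
  obtain ⟨e, D, hDe, hD0, hD⟩ := exists_isHomogeneous_of_ne_zero (mul_prod_X_ne_zero hG)
  refine ⟨e, D, hDe, hD0, fun v _ hDv => ⟨legCurve (triCurve p q),
    ⟨_, hC, squarefree_triCurve hp hq, rfl⟩, ?_⟩⟩
  obtain ⟨r, hr, hrv⟩ := hD v hDv
  obtain ⟨hGv, hv⟩ := ne_zero_of_eval_mul_prod_ne_zero hrv
  have hv0 : ∀ i, v i ≠ 0 := fun i => right_ne_zero_of_mul (hv i)
  obtain ⟨Φ, hΦ, hgerm⟩ := exists_germEquivBy hq hp hne hv0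
  have hs := ((hGs _ hGv).of_smul hP hr).legCurve_of_leg hq hv0
    (fun i => ne_zero_of_zpow_eq hp (hv0 i) (hΦ i)) hΦ
  exact ⟨Φ, hs.regularAt (isBihomogeneous_legCurve hC), hgerm⟩

/-! ### Isolated zeros of `Leg 𝓕_{p/q}` -/

/-- With one argument zero, a vanishing linear factor relates the `q`-th roots of the other two by a
root of unity and a sign. Taking `q`-th powers leaves `(-1)^q`, and squaring removes it. -/
theorem sq_eq_sq_of_eval_triNorm_eq_zero {q : ℕ} (hq : 0 < q) {z : Vec}
    (h : eval z (triNorm q) = 0) {i : Fin 3} (hi : z i = 0) : z (i + 1) ^ 2 = z (i + 2) ^ 2 := by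
  choose t ht using fun j => IsAlgClosed.exists_pow_nat_eq (z j) hq
  have hz : z = fun j => t j ^ q := funext fun j => (ht j).symm
  rw [hz, eval_triNorm hq, Finset.prod_eq_zero_iff] at h
  obtain ⟨m, -, h⟩ := h
  obtain ⟨n, -, h⟩ := Finset.prod_eq_zero_iff.mp h
  have hpow : ∀ m : ℕ, (zeta q ^ m) ^ q = 1 := fun m => by
    rw [← pow_mul, mul_comm, pow_mul, (zeta_isPrimitiveRoot hq).pow_eq_one, one_pow]
  have hsq : ∀ {a b x y : ℂ}, a ^ q = 1 → b ^ q = 1 → a * x + b * y = 0 →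
      (x ^ q) ^ 2 = (y ^ q) ^ 2 := by
    intro a b x y ha hb hab
    have h1 : a * x = -(b * y) := by linear_combination hab
    have h2 := congrArg (fun w => w ^ q) h1
    simp only [neg_pow (b * y), mul_pow, ha, hb, one_mul] at h2
    rw [h2, mul_pow, ← pow_mul, mul_comm q 2, pow_mul]
    norm_num
  have hti : t i = 0 := by
    rw [← ht i] at hi
    exact eq_zero_of_pow_eq_zero hi
  have h1 := hpow m
  have h2 := hpow n
  rw [hz]
  fin_cases i
  · exact hsq h1 h2 (by simp at hti; simp; linear_combination h - hti)
  · exact hsq h2 (one_pow q) (by simp at hti; simp; linear_combination h - zeta q ^ m * hti)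
  · exact hsq (one_pow q) h1 (by simp at hti; simp; linear_combination h - zeta q ^ n * hti)

theorem biEval_leg_triWeb (p : ℤ) (q : ℕ) (v a : Vec) : biEval (leg (triWeb p q)) v a =
    eval (fun i => eval a (powCoord p i) * v i ^ q) (triNorm q) := by
  rw [biEval_leg, biEval_triWeb]

theorem fin_three_add (i : Fin 3) : i + 1 + 1 = i + 2 ∧ i + 1 + 2 = i ∧ i + 2 + 1 = i ∧
    i + 2 + 2 = i + 1 := by
  fin_cases i <;> decide

theorem crossProduct_apply_add_one (v ξ : Vec) (i : Fin 3) :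
    crossProduct v ξ i = v (i + 1) * ξ (i + 2) - v (i + 2) * ξ (i + 1) := by
  rw [cross_apply]
  fin_cases i <;> simp

theorem eval_powCoord_neg {n : ℕ} (hn : n ≠ 0) (a : Vec) (i : Fin 3) :
    eval a (powCoord (-n) i) = (a (i + 1) * a (i + 2)) ^ n := by
  simp [powCoord, hn]

theorem div_zpow_eq_one_of_sq_eq {p : ℤ} {q : ℕ} {x y : ℂ} (hx : x ≠ 0) (hy : y ≠ 0)
    (hxy : (y ^ p * x ^ q) ^ 2 = (x ^ p * y ^ q) ^ 2) : (x / y) ^ (((q : ℤ) - p) * 2) = 1 := by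
  have hx' := zpow_ne_zero p hx
  have hy' := zpow_ne_zero p hy
  have hy'' := pow_ne_zero q hy
  have h1 : (x / y) ^ ((q : ℤ) - p) = (y ^ p * x ^ q) / (x ^ p * y ^ q) := by
    rw [zpow_sub₀ (div_ne_zero hx hy), zpow_natCast, div_zpow, div_pow]
    field_simp
  rw [zpow_mul, h1, zpow_ofNat, div_pow, hxy, div_self (pow_ne_zero 2 (mul_ne_zero hx' hy''))]

theorem div_zpow_eq_one_of_form_eq_zero {p : ℤ} {q : ℕ} (hq : 0 < q) (hp : p ≠ 0) {v : Vec}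
    (h : ∀ ξ, form (leg (triWeb p q)) v ξ = 0) {i : Fin 3} (h1 : v (i + 1) ≠ 0)
    (h2 : v (i + 2) ≠ 0) : (v (i + 1) / v (i + 2)) ^ (((q : ℤ) - p) * 2) = 1 := by
  obtain ⟨e11, e12, e21, e22⟩ := fin_three_add i
  obtain ⟨n4, n5, n2, n6⟩ : i + 1 ≠ i ∧ i + 2 ≠ i ∧ i ≠ i + 1 ∧ i + 2 ≠ i + 1 := by
    fin_cases i <;> decide
  have key := fun ξ => h ξ
  simp only [form, biEval_leg_triWeb] at key
  -- The test vectors `e_i + s e_{i+1}`; `s = 0` makes the `i`-th conormal coordinate vanish.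
  have hcr : ∀ s : ℂ, crossProduct v (Pi.single i 1 + Pi.single (i + 1) s) i = -(v (i + 2) * s) ∧
      crossProduct v (Pi.single i 1 + Pi.single (i + 1) s) (i + 1) = v (i + 2) ∧
      crossProduct v (Pi.single i 1 + Pi.single (i + 1) s) (i + 2) = v i * s - v (i + 1) := by
    intro s
    simp only [crossProduct_apply_add_one, e11, e12, e21, e22, Pi.add_apply, Pi.single_eq_same,
      Pi.single_eq_of_ne n4, Pi.single_eq_of_ne n5, Pi.single_eq_of_ne n2, Pi.single_eq_of_ne n6]
    refine ⟨?_, ?_, ?_⟩ <;> ring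
  obtain ⟨n, rfl | rfl⟩ := p.eq_nat_or_neg
  · have hn : n ≠ 0 := by exact_mod_cast hp
    obtain ⟨c0, c1, c2⟩ := hcr 0
    have h3 := sq_eq_sq_of_eval_triNorm_eq_zero hq
      (key (Pi.single i 1 + Pi.single (i + 1) 0)) (i := i) (by
      simp only [powCoord, Nat.cast_nonneg, if_true, Int.toNat_natCast, map_pow, eval_X, c0]
      simp [hn])
    simp only [powCoord, Nat.cast_nonneg, if_true, Int.toNat_natCast, map_pow, eval_X, c1, c2,
      mul_zero, zero_sub] at h3
    refine div_zpow_eq_one_of_sq_eq h1 h2 ?_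
    rw [zpow_natCast, zpow_natCast, h3, neg_pow, mul_pow, mul_pow, mul_pow, ← pow_mul, mul_comm n 2,
      pow_mul]
    norm_num
  · have hn : n ≠ 0 := by simpa using hp
    -- For `p < 0` a zero conormal coordinate kills the two other arguments of `N`. If `v i = 0`,
    -- the factor `v i ^ q` kills the `i`-th argument by itself, and `s = 1` keeps all three
    -- conormal coordinates nonzero.
    by_cases hi : v i = 0
    · obtain ⟨c0, c1, c2⟩ := hcr 1
      have h3 := sq_eq_sq_of_eval_triNorm_eq_zero hq
        (key (Pi.single i 1 + Pi.single (i + 1) 1)) (i := i) (by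
        simp only [hi]
        simp [hq.ne'])
      simp only [eval_powCoord_neg hn, e11, e12, e21, e22, c0, c1, c2, hi] at h3
      refine div_zpow_eq_one_of_sq_eq h1 h2 ?_
      have h4 : v (i + 1) ^ n ≠ 0 := pow_ne_zero n h1
      have h5 : v (i + 2) ^ n ≠ 0 := pow_ne_zero n h2
      have h6 : ((-1 : ℂ) ^ n) ^ 2 = 1 := by rw [← pow_mul, mul_comm, pow_mul]; norm_num
      have h7 : (v (i + 1) ^ n * v (i + 1) ^ q) ^ 2 = (v (i + 2) ^ n * v (i + 2) ^ q) ^ 2 := by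
        have e1 : ((0 * 1 - v (i + 1)) * -(v (i + 2) * 1)) ^ n =
            v (i + 1) ^ n * v (i + 2) ^ n := by rw [← mul_pow]; congr 1; ring
        have e2 : (-(v (i + 2) * 1) * v (i + 2)) ^ n =
            (-1) ^ n * (v (i + 2) ^ n * v (i + 2) ^ n) := by
          rw [← mul_pow, ← mul_pow]; congr 1; ring
        rw [e1, e2] at h3
        apply mul_left_cancel₀ (pow_ne_zero 2 h5)
        linear_combination h3 + (v (i + 2) ^ n * v (i + 2) ^ n) ^ 2 * (v (i + 2) ^ q) ^ 2 * h6
      rw [zpow_neg, zpow_neg, zpow_natCast, zpow_natCast]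
      field_simp
      linear_combination h7
    -- With `s = 0` the arguments `i + 1` and `i + 2` vanish but the `i`-th does not, so the form
    -- has no zero off the coordinate axes.
    · exfalso
      obtain ⟨c0, c1, c2⟩ := hcr 0
      have h3 := sq_eq_sq_of_eval_triNorm_eq_zero hq
        (key (Pi.single i 1 + Pi.single (i + 1) 0)) (i := i + 1) (by
        simp only [eval_powCoord_neg hn, e11, e12, c0]
        simp [hn])
      simp only [eval_powCoord_neg hn, e11, e12, e21, c0, c1, c2] at h3
      have h4 := h3.symm
      simp [hn, hi, h1, h2] at h4

theorem finite_setOf_pow_eq_one {n : ℕ} (hn : 0 < n) : {z : ℂ | z ^ n = 1}.Finite :=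
  (Polynomial.nthRootsFinset n (1 : ℂ)).finite_toSet.subset fun z hz => by
    rw [Finset.mem_coe, Polynomial.mem_nthRootsFinset hn]
    exact hz

/-- A set of points of the plane whose ratios of coordinates lie in a finite set is finite. -/
theorem finite_of_div_mem {S : Set ℂ} (hS : S.Finite) {Z : Set (Projectivization ℂ Vec)}
    (hZ : ∀ a ∈ Z, ∀ i j, a.rep j ≠ 0 → a.rep i / a.rep j ∈ S) : Z.Finite := by
  choose j hj using fun a : Projectivization ℂ Vec => Function.ne_iff.mp a.rep_nonzero
  refine Set.Finite.of_injOn (f := fun a i => a.rep i / a.rep (j a)) (t := {w | ∀ i, w i ∈ S})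
    (fun a ha i => hZ a ha i _ (hj a)) (fun a _ b _ hab => ?_) (Set.Finite.pi' fun _ => hS)
  rw [← a.mk_rep, ← b.mk_rep, Projectivization.mk_eq_mk_iff']
  refine ⟨a.rep (j a) / b.rep (j b), funext fun i => ?_⟩
  have h1 : a.rep i / a.rep (j a) = b.rep i / b.rep (j b) := congrFun hab i
  have h2 : a.rep (j a) ≠ 0 := hj a
  have h3 : b.rep (j b) ≠ 0 := hj b
  rw [Pi.smul_apply, smul_eq_mul]
  rw [div_eq_div_iff h2 h3] at h1
  field_simp
  linear_combination -h1

theorem finite_zeros_leg_triWeb {p : ℤ} {q : ℕ} (hq : 0 < q) (hp : p ≠ 0) (hne : p ≠ q) :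
    {v : Projectivization ℂ Vec | ∀ ξ : Vec, form (leg (triWeb p q)) v.rep ξ = 0}.Finite := by
  set N : ℤ := ((q : ℤ) - p) * 2 with hN
  have hN0 : N ≠ 0 := mul_ne_zero (sub_ne_zero.mpr hne.symm) two_ne_zero
  have hpow : ∀ {z : ℂ}, z ^ N = 1 → z ^ N.natAbs = 1 := by
    intro z hz
    rcases Int.natAbs_eq N with h | h
    · rw [h, zpow_natCast] at hz
      exact hz
    · rwa [h, zpow_neg, zpow_natCast, inv_eq_one] at hz
  refine finite_of_div_mem
    ((finite_setOf_pow_eq_one (Int.natAbs_pos.mpr hN0)).insert 0) fun a ha i j hj => ?_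
  by_cases hi : a.rep i = 0
  · exact Or.inl (by rw [hi, zero_div])
  · refine Or.inr (hpow ?_)
    have hcases : ∀ i j : Fin 3, j = i ∨ (∃ l : Fin 3, i = l + 1 ∧ j = l + 2) ∨
        ∃ l : Fin 3, j = l + 1 ∧ i = l + 2 := by
      decide
    rcases hcases i j with rfl | ⟨l, rfl, rfl⟩ | ⟨l, rfl, rfl⟩
    · rw [div_self hj, one_zpow]
    · exact div_zpow_eq_one_of_form_eq_zero hq hp ha hi hj
    · rw [← inv_div, inv_zpow, div_zpow_eq_one_of_form_eq_zero hq hp ha hj hi, inv_one]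

theorem isWeb_leg_triWeb {p : ℤ} {q : ℕ} (hq : 0 < q) (hp : p ≠ 0) (hne : p ≠ q) :
    IsWeb (leg (triWeb p q)) (triDegree p q) (q ^ 2) := by
  obtain ⟨v, c, c', h⟩ := exists_separableAt_leg_triWeb hq hp hne
  have hP := isBihomogeneous_leg_triWeb p hq
  rw [mul_powDegree hp] at hP
  exact ⟨hP, ⟨v, h.regularAt hP⟩, finite_zeros_leg_triWeb hq hp hne⟩

/-! ### The `q²` pencils of part (a) -/

theorem prod_fin_sq {q : ℕ} (F : ℕ → ℕ → ℂ) :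
    ∏ i : Fin (q ^ 2), F (i / q + 1) (i % q + 1) =
      ∏ m ∈ Finset.Icc 1 q, ∏ n ∈ Finset.Icc 1 q, F m n := by
  have hI : ∀ G : ℕ → ℂ, ∏ m ∈ Finset.Icc 1 q, G m = ∏ m : Fin q, G (m + 1) := by
    intro G
    rw [Fin.prod_univ_eq_prod_range (fun m => G (m + 1)), Finset.range_eq_Ico,
      Finset.prod_Ico_add' G 0 q 1, zero_add]
    rfl
  simp only [hI]
  rw [← Fintype.prod_prod_type' (f := fun m n : Fin q => F (m + 1) (n + 1))]
  refine (Fintype.prod_equiv (finProdFinEquiv.trans (finCongr (pow_two q).symm)) _ _ ?_).symm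
  rintro ⟨m, n⟩
  have hq : 0 < q := m.pos
  simp only [Equiv.trans_apply, finProdFinEquiv_apply_val, finCongr_apply, Fin.val_cast]
  rw [Nat.add_mul_div_left _ _ hq, Nat.div_eq_of_lt n.2, zero_add, Nat.add_mul_mod_self_left,
    Nat.mod_eq_of_lt n.2]

/-- The base points `(1 : ζ^m : ζ^n)` of the pencils. -/
def pencilBase (q : ℕ) (i : Fin (q ^ 2)) : Vec :=
  ![1, zeta q ^ (i / q + 1 : ℕ), zeta q ^ (i % q + 1 : ℕ)]

theorem biEval_prod_pencil (q : ℕ) (v a : Vec) :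
    biEval (∏ i, pencil (pencilBase q i)) v a = eval a (triProd q) := by
  rw [biEval, map_prod, eval_triProd,
    ← prod_fin_sq (fun m n => a 0 + zeta q ^ m * a 1 + zeta q ^ n * a 2)]
  refine Finset.prod_congr rfl fun i _ => ?_
  have h := biEval_pencil (pencilBase q i) v a
  rw [biEval] at h
  rw [h, Fin.sum_univ_three]
  simp [pencilBase]

theorem prod_pencil_eq_legCurve (q : ℕ) :
    ∏ i, pencil (pencilBase q i) = legCurve (triProd q) := by
  refine MvPolynomial.funext fun x => ?_
  have h : x = Sum.elim (fun i => x (Sum.inl i)) (fun i => x (Sum.inr i)) := by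
    funext j
    rcases j with j | j <;> rfl
  rw [h]
  exact (biEval_prod_pencil q _ _).trans (biEval_legCurve _ _ _).symm

theorem pencilBase_injective (q : ℕ) : Function.Injective (pencilBase q) := by
  intro i j hij
  rcases Nat.eq_zero_or_pos q with rfl | hq
  · exact absurd i.2 (by simp)
  have hlt : ∀ i : Fin (q ^ 2), (i : ℕ) / q < q := fun i =>
    Nat.div_lt_of_lt_mul (by rw [← pow_two]; exact i.2)
  have hmem : ∀ {m : ℕ}, m < q → m + 1 ∈ ((Finset.Icc 1 q : Finset ℕ) : Set ℕ) := fun h => by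
    rw [Finset.mem_coe, Finset.mem_Icc]; omega
  have h1 : zeta q ^ ((i : ℕ) / q + 1) = zeta q ^ ((j : ℕ) / q + 1) := congrFun hij 1
  have h2 : zeta q ^ ((i : ℕ) % q + 1) = zeta q ^ ((j : ℕ) % q + 1) := congrFun hij 2
  have h3 := injOn_zeta_pow hq (hmem (hlt i)) (hmem (hlt j)) h1
  have h4 := injOn_zeta_pow hq (hmem (Nat.mod_lt _ hq)) (hmem (Nat.mod_lt _ hq)) h2
  ext
  rw [← Nat.div_add_mod (i : ℕ) q, ← Nat.div_add_mod (j : ℕ) q, Nat.add_right_cancel h3,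
    Nat.add_right_cancel h4]

theorem linearIndependent_pencilBase {q : ℕ} {i j : Fin (q ^ 2)} (hij : i ≠ j) :
    LinearIndependent ℂ ![pencilBase q i, pencilBase q j] := by
  rw [LinearIndependent.pair_iff]
  intro s t hst
  have h0 : s + t = 0 := by simpa [pencilBase] using congrFun hst 0
  obtain rfl : t = -s := by linear_combination h0
  rw [neg_smul, ← sub_eq_add_neg, ← smul_sub, smul_eq_zero, sub_eq_zero] at hst
  have hs := hst.resolve_right fun h => hij (pencilBase_injective q h)
  exact ⟨hs, by rw [hs, neg_zero]⟩

end PlaneWeb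

end

theorem propositionP (p : ℤ) (q : ℕ) (hq : 0 < q) (hpq : IsCoprime p (q : ℤ))
    (hne : p ≠ (q : ℤ)) :
    (∃ w : Fin (q ^ 2) → PlaneWeb.Vec,
        (∀ i, w i ≠ 0) ∧
        (∀ i j, i ≠ j → LinearIndependent ℂ ![w i, w j]) ∧
        PlaneWeb.IsAlgebraicWeb (∏ i, PlaneWeb.pencil (w i)) (q ^ 2) ∧
        PlaneWeb.IsPowerPullback ((q : ℚ) / ((q : ℚ) - (p : ℚ))) (PlaneWeb.triWeb p q)
          (∏ i, PlaneWeb.pencil (w i))) ∧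
    (p ≠ 0 →
        PlaneWeb.IsPowerPullback ((p : ℚ) / ((p : ℚ) - (q : ℚ))) (PlaneWeb.leg (PlaneWeb.triWeb p q))
          (PlaneWeb.legCurve (PlaneWeb.triCurve p q)) ∧
        PlaneWeb.IsWeb (PlaneWeb.leg (PlaneWeb.triWeb p q)) (PlaneWeb.triDegree p q) (q ^ 2) ∧
        PlaneWeb.IsAlgebraizable (PlaneWeb.leg (PlaneWeb.triWeb p q))
          (PlaneWeb.triDegree p q)) := by
  refine ⟨⟨PlaneWeb.pencilBase q, fun i h => one_ne_zero (congrFun h 0),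
    fun i j hij => PlaneWeb.linearIndependent_pencilBase hij,
    ⟨PlaneWeb.triProd q, pow_two q ▸ PlaneWeb.isHomogeneous_triProd q,
      PlaneWeb.squarefree_triProd hq, PlaneWeb.prod_pencil_eq_legCurve q⟩,
    PlaneWeb.isPowerPullback_triWeb hq hne (PlaneWeb.biEval_prod_pencil q)⟩, fun hp => ?_⟩
  exact ⟨PlaneWeb.isPowerPullback_leg_triWeb hq hp hne, PlaneWeb.isWeb_leg_triWeb hq hp hne,
    PlaneWeb.isAlgebraizable_leg_triWeb hq hp hne⟩
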